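/- Let $p\ge 0$, let $h$ be a hermitian form of signature $(3,p)$ on $\mathbb C^{3+p}$, let $\Omega\subset\mathbb P(\mathbb C^{3+p})$ be the open set of lines on which $h$ is positive, and let $\omega:=i\Theta(\mathcal O(-1)|_\Omega,h)$, i.e. $\omega=-i\partial\bar\partial\log h(s,s)$ for any local non-vanishing holomorphic section $s$ of $\mathcal O(-1)$. It is a non-degenerate pseudo-Kähler form; we identify it with the pseudo-hermitian metric $(g_{jk})$ on $T_\Omega$ such that $\omega=\sum_{j,k} g_{jk}\,\frac i2\,dw_j\wedge d\bar w_k$ in local coordinates. Let $\mathbb P(T_\Omega)^+$ be the set of lines in $T_\Omega$ on which $\omega$ is positive definite. For a non-constant holomorphic map $f$ from (an open subset of) $\mathbb C$ to $\Omega$, let $f_{[1]}=(f,[f'])$ be its lift to $P_1\Omega=\mathbb P(T_\Omega)$ (at a zero $x$ of $f'$, where $f'=(z-x)^m g$ with $g(x)\neq0$, the line $[f'(x)]$ means $[g(x)]$), and let $f_{[2]}$ be its lift to the second stage $P_2\Omega=\mathbb P(V_1)$ of the Demailly–Semple tower, where $V_1\subset T_{P_1\Omega}$ consists of the vectors at $(l,L)$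 whose projection to $T_{\Omega,l}$ lies in $L$; the derivative $f_{[1]}'(x)$ lies in the line $f_{[2]}(x)\subset V_1$. Suppose that $[f'(x)]\in\mathbb P(T_\Omega)^+$ for all $x$. Let $\mathcal L\subset f^*T_\Omega$ be the line subbundle with fibres $[f'(x)]$, let $\nabla$ be the Chern connection of $(f^*T_\Omega,f^*\omega)$, let $\psi\in \mathrm{Hom}(\mathcal L,\mathcal L^\perp)$, $\psi(X)=\mathrm{pr}_{\mathcal L^\perp}(\nabla_{\partial/\partial z}X)$, be the second fundamental form of $\mathcal L$ evaluated on $\partial/\partial z$, let $\|\psi\|^2=\omega(\psi(X),\psi(X))/\omega(X,X)$ for $0\ne X\in\mathcal L$ (a real number, possibly negative), and put $\sigma_f:=\|\psi\|^2\,\frac i2dz\wedge d\bar z$. For a continuous real $(1,1)$-form $\alpha$ on $\mathbb C$ write $T_\alpha(r)=\int_1^r\frac{dt}t\int_{|z|<t}\alpha$, and $T_{f,\omega}:=T_{f^*\omega}$. Then: (a) $\sigma_f(x)$ depends only on the point $f_{[2]}(x)\in P_2\Omega$, in the sense that it is the pull-back, by $\partial/\partial z\mapsto f_{[1]}'(x)$,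 of a hermitian form on the tautological line over this point: if $f$ and $g$ are two germs as above, at $x$ and at $y$, with $f_{[2]}(x)=g_{[2]}(y)$ and $f_{[1]}'(x)=c\,g_{[1]}'(y)$ with $c\in\mathbb C$, then $\|\psi_f\|^2(x)=|c|^2\,\|\psi_g\|^2(y)$. (b) There is $\gamma>0$, depending only on $p$ and $h$, such that the holomorphic sectional curvature of $\omega$ is equal to $-\gamma$ on every line in $\mathbb P(T_\Omega)^+$ and such that for every non-constant holomorphic map $f:\mathbb C\to\Omega$ with $[f'(x)]\in\mathbb P(T_\Omega)^+$ for all $x\in\mathbb C$ the forms $f^*\omega$ and $\sigma_f$ are continuous and $$\gamma\,T_{f,\omega}(r)+T_{\sigma_f}(r)\le_{\mathrm{exc}} O\big(\log r+\log T_{f,\omega}(r)\big),$$ i.e. there are a constant $C>0$ and a set $S$ of finite Lebesgue measure (both may depend on $f$) with $\gamma T_{f,\omega}(r)+T_{\sigma_f}(r)\le C(\log r+\log T_{f,\omega}(r))$ for all $r\in[1,\infty)\setminus S$. -/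

import Mathlib

open Filter Topology MeasureTheory

noncomputable section

namespace EntireCurve

/-! ### Linear algebra: a hermitian form of signature `(3, p)` and its positive lines -/

/-- The vector space `ℂ^(3+p)`. -/
abbrev V (p : ℕ) : Type := Fin (p + 3) → ℂ

/-- The model `ℂ^(p+2)` of the affine charts of `ℙ(V p)`; it is also the fibre of the tangent bundle
in the trivialisation given by such a chart. -/
abbrev E (p : ℕ) : Type := Fin (p + 2) → ℂ

/-- A sesquilinear form on `ℂ^(3+p)`, linear in the first variable and conjugate linear in the
second one. -/
abbrev Sesq (p : ℕ) : Type := V p →ₗ[ℂ] V p →ₗ⋆[ℂ] ℂ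

/-- `h` is a hermitian form of signature `(3, p)`: it is diagonal in some basis, with `3` diagonal
entries `1` and `p` diagonal entries `-1`. -/
def HasSignature {p : ℕ} (h : Sesq p) : Prop :=
  ∃ b : Module.Basis (Fin 3 ⊕ Fin p) ℂ (V p), ∀ i j,
    h (b i) (b j) = if i = j then Sum.elim (fun _ => (1 : ℂ)) (fun _ => -1) i else 0

/-- The domain `Ω ⊆ ℙ(ℂ^(3+p))` of the lines on which `h` is positive. -/
def Omega {p : ℕ} (h : Sesq p) : Set (Projectivization ℂ (V p)) :=
  {l | ∀ v ∈ l.submodule, v ≠ 0 → 0 < (h v v).re}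

/-! ### The standard affine charts of the projective space -/

/-- The section `w ↦ (w₀, …, 1, …, w_{p+1})` (with `1` at place `i`) of `𝒪(-1)` over the `i`-th
affine chart; the line it spans is the point of `ℙ(V p)` with affine coordinates `w`. -/
def chartSection {p : ℕ} (i : Fin (p + 3)) (w : E p) : V p := i.insertNth (1 : ℂ) w

/-- The point `l` lies in the `i`-th affine chart. -/
def InChart {p : ℕ} (i : Fin (p + 3)) (l : Projectivization ℂ (V p)) : Prop := l.rep i ≠ 0

/-- The affine coordinates `(v_j / v_i)_{j ≠ i}` of the line `l = [v]` in the `i`-th chart. -/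
def coord {p : ℕ} (i : Fin (p + 3)) (l : Projectivization ℂ (V p)) : E p :=
  fun k => l.rep (i.succAbove k) / l.rep i

theorem exists_inChart {p : ℕ} (l : Projectivization ℂ (V p)) : ∃ i, InChart i l :=
  Function.ne_iff.mp l.rep_nonzero

/-- Some affine chart containing `l`. The tensors defined below through this chart do not depend on
the choice. -/
def chartAt {p : ℕ} (l : Projectivization ℂ (V p)) : Fin (p + 3) := (exists_inChart l).choose

/-! ### Wirtinger derivatives -/

section Wirtinger

variable {B : Type*} [NormedAddCommGroup B] [NormedSpace ℂ B]

/-- `∂F(ξ)`: the derivative of `F` at `x` along the `(1,0)`-vector given by `ξ`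
(so `ξ = e_j` gives `∂F/∂z_j`). -/
def dW (F : B → ℂ) (x ξ : B) : ℂ :=
  (fderiv ℝ F x ξ - Complex.I * fderiv ℝ F x (Complex.I • ξ)) / 2

/-- `∂̄F(ξ̄)`: the derivative of `F` at `x` along the conjugate of the `(1,0)`-vector given by `ξ`
(so `ξ = e_j` gives `∂F/∂z̄_j`). -/
def dWbar (F : B → ℂ) (x ξ : B) : ℂ :=
  (fderiv ℝ F x ξ + Complex.I * fderiv ℝ F x (Complex.I • ξ)) / 2

end Wirtinger

/-! ### Pseudo-hermitian metrics on a trivialised holomorphic bundle, Chern connection, curvature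

A pseudo-hermitian metric on the trivial bundle with holomorphic frame `(e_k)` over (an open subset
of) `B` is given by its Gram matrix `H b j k = h_b(e_j, e_k)`. -/

section Chern

variable {B : Type*} [NormedAddCommGroup B] [NormedSpace ℂ B] {ι : Type*} [Fintype ι]

/-- The value `h(u, v) = ∑ u_j H_{jk} v̄_k` of the sesquilinear form with Gram matrix `M`. -/
def herm (M : Matrix ι ι ℂ) (u v : ι → ℂ) : ℂ := u ⬝ᵥ (M.mulVec (star v))

/-- The orthogonal projection onto the orthogonal of the non-isotropic line spanned by `X`. -/
def projOrth (M : Matrix ι ι ℂ) (X w : ι → ℂ) : ι → ℂ := w - (herm M w X / herm M X X) • X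

variable [DecidableEq ι]

/-- The matrix `A = ∂H · H⁻¹` of the Chern connection evaluated on the `(1,0)`-vector `ξ`:
`∇_ξ e_j = ∑_k A_{jk} e_k`. -/
def chernForm (H : B → Matrix ι ι ℂ) (b ξ : B) : Matrix ι ι ℂ :=
  Matrix.of (fun j k => dW (fun b' => H b' j k) b ξ) * (H b)⁻¹

/-- The curvature `Θ = ∂̄A` of the Chern connection: the vector `Θ(ξ, η̄) u`. -/
def chernCurvature (H : B → Matrix ι ι ℂ) (b ξ η : B) (u : ι → ℂ) : ι → ℂ :=
  Matrix.vecMul u (Matrix.of fun j k => -dWbar (fun b' => chernForm H b' ξ j k) b η)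

/-- The covariant derivative `∇_{∂/∂z} s` at `x` of a holomorphic section `s` (given by its
components) of a bundle over (an open subset of) `ℂ`, for the Chern connection. -/
def covDeriv (H : ℂ → Matrix ι ι ℂ) (s : ℂ → ι → ℂ) (x : ℂ) : ι → ℂ :=
  deriv s x + Matrix.vecMul (s x) (chernForm H x 1)

end Chern

/-! ### The pseudo-Kähler metric `ω` of `Ω` -/

/-- The Gram matrix `g` of `ω` in the `i`-th chart, where `ω = iΘ(𝒪(-1), h) = -i∂∂̄ log h(s, s)`,
`s` the local section of `𝒪(-1)` above, and the form `ω` and the metric `g` correspond to each other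
through `ω = ∑ g_{jk} (i/2) dw_j ∧ dw̄_k`. -/
def gram {p : ℕ} (h : Sesq p) (i : Fin (p + 3)) (w : E p) : Matrix (Fin (p + 2)) (Fin (p + 2)) ℂ :=
  Matrix.of fun j k => -2 * dW (fun w' =>
    dWbar (fun w'' => (Real.log (h (chartSection i w'') (chartSection i w'')).re : ℂ)) w'
      (Pi.single k 1)) w (Pi.single j 1)

/-- The holomorphic sectional curvature of `ω` at the point with coordinates `w` in the `i`-th
chart, in the direction of the tangent vector with components `u`. -/
def holSecCurv {p : ℕ} (h : Sesq p) (i : Fin (p + 3)) (w u : E p) : ℂ :=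
  herm (gram h i w) (chernCurvature (gram h i) w u u u) u / herm (gram h i w) u u ^ 2

/-! ### Curves -/

/-- `f` is holomorphic near `x`: it lifts there to a holomorphic nowhere zero map to `ℂ^(3+p)`. -/
def HolomorphicNear {p : ℕ} (f : ℂ → Projectivization ℂ (V p)) (x : ℂ) : Prop :=
  ∃ F : ℂ → V p, AnalyticAt ℂ F x ∧
    ∀ᶠ z in 𝓝 x, ∃ hz : F z ≠ 0, f z = Projectivization.mk ℂ (F z) hz

/-- The expression of `f` in the `i`-th chart. -/
def inCoord {p : ℕ} (i : Fin (p + 3)) (f : ℂ → Projectivization ℂ (V p)) : ℂ → E p :=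
  fun z => coord i (f z)

/-- For a curve `c`, holomorphic and not constant near `x`: the holomorphic map `X`, non-zero at
`x`, such that `c'(z) = (z - x)^m X(z)` near `x`, where `m` is the order of vanishing of `c'` at
`x`. Near `x`, `X` generates the line subbundle of the pulled back tangent bundle given by the
(extended) tangent directions of `c`. -/
def tangentGen {W : Type*} [NormedAddCommGroup W] [NormedSpace ℂ W] (c : ℂ → W) (x : ℂ) : ℂ → W :=
  (Function.swap dslope x)^[analyticOrderNatAt (deriv c) x] (deriv c)

/-- The lifted tangent direction `[f'(x)]` lies in the open set of the directions on which `ω` is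
positive. -/
def PositiveAt {p : ℕ} (h : Sesq p) (f : ℂ → Projectivization ℂ (V p)) (x : ℂ) : Prop :=
  let φ := inCoord (chartAt (f x)) f
  let X := tangentGen φ x
  0 < (herm (gram h (chartAt (f x)) (φ x)) (X x) (X x)).re

/-- A germ at `x` of holomorphic curve in `Ω` whose lifted tangent direction at `x` is
`ω`-positive (so the germ is not constant). -/
structure PositiveGerm {p : ℕ} (h : Sesq p) (f : ℂ → Projectivization ℂ (V p)) (x : ℂ) : Prop where
  holo : HolomorphicNear f x
  mem : f x ∈ Omega h
  pos : PositiveAt h f x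

/-- The density of `f^*ω`, that is `f^*ω = (pullbackDensity h f) (i/2) dz ∧ dz̄`. -/
def pullbackDensity {p : ℕ} (h : Sesq p) (f : ℂ → Projectivization ℂ (V p)) (x : ℂ) : ℝ :=
  let φ := inCoord (chartAt (f x)) f
  (herm (gram h (chartAt (f x)) (φ x)) (deriv φ x) (deriv φ x)).re

/-- The density `‖ψ‖²` of `σ_f = ‖ψ‖² (i/2) dz ∧ dz̄`. Here `𝓛 ⊆ f^*T_Ω` is the line subbundle of
the tangent directions of `f`, generated near `x` by `X`, `ψ : 𝓛 → 𝓛^⊥` is its second fundamental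
form evaluated on `∂/∂z`, so that `ψ(X) = pr_{𝓛^⊥}(∇_{∂/∂z} X)` with `∇` the Chern connection of
`(f^*T_Ω, f^*ω)`, and `‖ψ‖² = ‖ψ(X)‖² / ‖X‖²` (which may be negative). -/
def sigmaDensity {p : ℕ} (h : Sesq p) (f : ℂ → Projectivization ℂ (V p)) (x : ℂ) : ℝ :=
  let φ := inCoord (chartAt (f x)) f
  let X := tangentGen φ x
  let H := fun z => gram h (chartAt (f x)) (φ z)
  let ψX := projOrth (H x) (X x) (covDeriv H X x)
  (herm (H x) ψX ψX).re / (herm (H x) (X x) (X x)).re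

/-! ### Demailly-Semple lifts

`P₁Ω = ℙ(T_Ω)` has the charts `(i, j)`: affine coordinates `w ∈ ℂ^(p+2)` on the base, and the
affine coordinates `(u_k / u_j)_{k ≠ j}` of a tangent direction `[u]`. In such a chart
`P₂Ω = ℙ(V₁)`, where `V₁ ⊆ T_{P₁Ω}` consists of the vectors over `(w, [u])` whose projection to
`T_Ω` lies in the line spanned by `u`, is the set of pairs (point of `P₁Ω`, line in `V₁`). -/

/-- The lift `f_[1] = (f, [f'])` near `x`, in the chart `(i, j)` of `P₁Ω`. -/
def lift1 {p : ℕ} (i : Fin (p + 3)) (j : Fin (p + 2)) (f : ℂ → Projectivization ℂ (V p)) (x : ℂ) :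
    ℂ → E p × (Fin (p + 1) → ℂ) :=
  let φ := inCoord i f
  let X := tangentGen φ x
  fun z => (φ z, fun k => X z (j.succAbove k) / X z j)

/-- The point `f_[1](x)` lies in the chart `(i, j)` of `P₁Ω`. -/
def Lift1InChart {p : ℕ} (i : Fin (p + 3)) (j : Fin (p + 2))
    (f : ℂ → Projectivization ℂ (V p)) (x : ℂ) : Prop :=
  InChart i (f x) ∧ tangentGen (inCoord i f) x x j ≠ 0

/-- The point `f_[2](x) = (f_[1](x), [f_[1]'(x)])` of `P₂Ω`, read in the chart `(i, j)` of `P₁Ω`. -/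
def lift2 {p : ℕ} (i : Fin (p + 3)) (j : Fin (p + 2)) (f : ℂ → Projectivization ℂ (V p)) (x : ℂ) :
    (E p × (Fin (p + 1) → ℂ)) × Submodule ℂ (E p × (Fin (p + 1) → ℂ)) :=
  (lift1 i j f x x, Submodule.span ℂ {tangentGen (lift1 i j f x) x x})

/-- The vector `f_[1]'(x)` of the tautological line of `P₂Ω` over `f_[2](x)`. -/
def velocity1 {p : ℕ} (i : Fin (p + 3)) (j : Fin (p + 2)) (f : ℂ → Projectivization ℂ (V p))
    (x : ℂ) : E p × (Fin (p + 1) → ℂ) :=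
  deriv (lift1 i j f x) x

/-! ### Characteristic functions -/

/-- The characteristic function `T_α(r) = ∫_1^r dt/t ∫_{|z| < t} α` of the form
`α = ρ (i/2) dz ∧ dz̄ = ρ dx ∧ dy`. -/
def charFun (ρ : ℂ → ℝ) (r : ℝ) : ℝ :=
  ∫ t in (1 : ℝ)..r, (∫ z in Metric.ball (0 : ℂ) t, ρ z) / t

/-- `A ≤_exc O(G)`: for some constant `C`, `A ≤ C G` on `[1, ∞)` outside a subset of finite Lebesgue
measure. -/
def LeExcO (A G : ℝ → ℝ) : Prop :=
  ∃ C : ℝ, 0 < C ∧ ∃ S : Set ℝ, volume S < ⊤ ∧ ∀ r : ℝ, 1 ≤ r → r ∉ S → A r ≤ C * G r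

end EntireCurve

end

/-! Everything is expressed through `h` and the Gram form of pairs, written here |s∧u|² =
h(s,s)h(u,u) - |h(u,s)|² (`gram2`). In a chart with section s, ω(u,u) = -2|s∧u|²/h(s,s)², and for
constant u the Chern connection is ∇_ξ u = -a(u)ξ - a(ξ)u with a = ∂ log h(s,s). Since ∂̄a = -ω/2,
the curvature is algebraic in ω and the holomorphic sectional curvature is -1, so γ = 1.

Along a curve with tangent field X, both correction terms of ∇X are multiples of X. Hence ψ(X) is X'
modulo X, and ‖ψ‖² is a quotient of Gram determinants of s, X, X' (`frameSigma`), unchanged under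
change of lift, of chart and of generator (`frameSigma_change`). In a chart of P₁Ω, X may be
replaced by (1, r) and X' by (0, r'), where r is the fibre coordinate of f_[1]. The result is a
hermitian form in r', which is (a) (`sigmaDensity_eq_lift1`).

For (b), let F be a local lift of f with F' = (z-x)^m Y. The density of f^*ω is D = |z-x|^(2m) e^v
with v = log 2 + log(-|F∧Y|²) - 2 log h(F,F). Because F' is parallel to Y, the derivative of F∧Y is
F∧Y', so ∂∂̄ log|F∧Y|² is the density of σ_f, while -2∂∂̄ log h(F,F) = D. Thus ∂∂̄v is the density
of f^*ω + σ_f (`exists_local_potential`). Jensen's formula bounds the characteristic function of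
this sum by circle averages of log D, the zeros of D having the favourable sign
(`HasPotentials.charFun_le`). Concavity of log and two applications of Borel's growth lemma bound
the average of log D by O(log r + log T) (`HasPotentials.leExcO`). -/

noncomputable section

namespace EntireCurve

/-! ### Calculus of Wirtinger derivatives. -/

section WirtingerCalculus

variable {B : Type*} [NormedAddCommGroup B] [NormedSpace ℂ B]

/-- `F` is real differentiable at `x`, with `∂F = a` and `∂̄F = b` there. -/
def HasWirtingerAt (F : B → ℂ) (a b : B → ℂ) (x : B) : Prop :=
  ∃ L : B →L[ℝ] ℂ, HasFDerivAt F L x ∧ (∀ ξ, L ξ = a ξ + b ξ) ∧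
    (∀ ξ, a (Complex.I • ξ) = Complex.I * a ξ) ∧ ∀ ξ, b (Complex.I • ξ) = -(Complex.I * b ξ)

variable {F G : B → ℂ} {a b a' b' : B → ℂ} {x : B}

theorem HasWirtingerAt.dW_eq (hF : HasWirtingerAt F a b x) (ξ : B) : dW F x ξ = a ξ := by
  obtain ⟨L, hL, hab, ha, hb⟩ := hF
  rw [dW, hL.fderiv, hab, hab, ha, hb]
  linear_combination (-(a ξ - b ξ) / 2) * Complex.I_sq

theorem HasWirtingerAt.dWbar_eq (hF : HasWirtingerAt F a b x) (ξ : B) : dWbar F x ξ = b ξ := by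
  obtain ⟨L, hL, hab, ha, hb⟩ := hF
  rw [dWbar, hL.fderiv, hab, hab, ha, hb]
  linear_combination ((a ξ - b ξ) / 2) * Complex.I_sq

theorem HasWirtingerAt.congr (hF : HasWirtingerAt F a b x) (h : G =ᶠ[𝓝 x] F) :
    HasWirtingerAt G a b x := by
  obtain ⟨L, hL, hab⟩ := hF
  exact ⟨L, hL.congr_of_eventuallyEq h, hab⟩

theorem HasWirtingerAt.congr_deriv (hF : HasWirtingerAt F a b x) (ha : ∀ ξ, a' ξ = a ξ)
    (hb : ∀ ξ, b' ξ = b ξ) : HasWirtingerAt F a' b' x := by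
  obtain rfl : a' = a := funext ha
  obtain rfl : b' = b := funext hb
  exact hF

theorem hasWirtingerAt_const (c : ℂ) : HasWirtingerAt (fun _ : B => c) (fun _ => 0) (fun _ => 0) x :=
  ⟨0, hasFDerivAt_const _ _, by simp, by simp, by simp⟩

theorem HasWirtingerAt.sub (hF : HasWirtingerAt F a b x) (hG : HasWirtingerAt G a' b' x) :
    HasWirtingerAt (fun z => F z - G z) (fun ξ => a ξ - a' ξ) (fun ξ => b ξ - b' ξ) x := by
  obtain ⟨L, hL, hab, ha, hb⟩ := hF
  obtain ⟨L', hL', hab', ha', hb'⟩ := hG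
  refine ⟨L - L', hL.sub hL', fun ξ => ?_, fun ξ => ?_, fun ξ => ?_⟩
  · simp only [sub_apply, hab, hab']; ring
  · simp only [ha, ha']; ring
  · simp only [hb, hb']; ring

theorem HasWirtingerAt.mul (hF : HasWirtingerAt F a b x) (hG : HasWirtingerAt G a' b' x) :
    HasWirtingerAt (fun z => F z * G z) (fun ξ => a ξ * G x + F x * a' ξ)
      (fun ξ => b ξ * G x + F x * b' ξ) x := by
  obtain ⟨L, hL, hab, ha, hb⟩ := hF
  obtain ⟨L', hL', hab', ha', hb'⟩ := hG
  refine ⟨_, hL.mul hL', fun ξ => ?_, fun ξ => ?_, fun ξ => ?_⟩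
  · simp only [add_apply, smul_apply, smul_eq_mul, hab,
      hab']
    ring
  · simp only [ha, ha']; ring
  · simp only [hb, hb']; ring

theorem HasWirtingerAt.inv (hF : HasWirtingerAt F a b x) (h0 : F x ≠ 0) :
    HasWirtingerAt (fun z => (F z)⁻¹) (fun ξ => -a ξ / F x ^ 2) (fun ξ => -b ξ / F x ^ 2) x := by
  obtain ⟨L, hL, hab, ha, hb⟩ := hF
  refine ⟨_, ((hasDerivAt_inv h0).complexToReal_fderiv).comp x hL, fun ξ => ?_, fun ξ => ?_,
    fun ξ => ?_⟩
  · simp [hab]; ring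
  · simp only [ha]; ring
  · simp only [hb]; ring

theorem HasWirtingerAt.div (hF : HasWirtingerAt F a b x) (hG : HasWirtingerAt G a' b' x)
    (h0 : G x ≠ 0) :
    HasWirtingerAt (fun z => F z / G z) (fun ξ => (a ξ * G x - F x * a' ξ) / G x ^ 2)
      (fun ξ => (b ξ * G x - F x * b' ξ) / G x ^ 2) x := by
  refine ((hF.mul (hG.inv h0)).congr_deriv (fun ξ => ?_) fun ξ => ?_).congr
    (.of_forall fun z => div_eq_mul_inv _ _)
  all_goals field_simp; ring

/-- `Real.log` is log of the absolute value, so `F` may be negative; it is for the Gram determinant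
of a positive direction. -/
theorem HasWirtingerAt.log_re (hF : HasWirtingerAt F a b x) (h0 : F x ≠ 0)
    (hreal : ∀ᶠ z in 𝓝 x, (F z).im = 0) :
    HasWirtingerAt (fun z => (Real.log (F z).re : ℂ)) (fun ξ => a ξ / F x) (fun ξ => b ξ / F x)
      x := by
  obtain ⟨L, hL, hab, ha, hb⟩ := hF
  have hx : ((F x).re : ℂ) = F x := Complex.ext rfl (by simp [hreal.self_of_nhds])
  have hre : (F x).re ≠ 0 := fun h => h0 (by rw [← hx, h]; simp)
  -- `F` is real near `x`, so its derivative is real and passing to the real part loses nothing.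
  have him : ∀ ξ, (L ξ).im = 0 := by
    have h1 : HasFDerivAt (fun z => (F z).im) (Complex.imCLM.comp L) x :=
      Complex.imCLM.hasFDerivAt.comp x hL
    have h2 : HasFDerivAt (fun z => (F z).im) (0 : B →L[ℝ] ℝ) x :=
      (hasFDerivAt_const (0 : ℝ) x).congr_of_eventuallyEq hreal
    intro ξ
    simpa using congrArg (fun M : B →L[ℝ] ℝ => M ξ) (h1.unique h2)
  have h3 := (Complex.ofRealCLM.hasFDerivAt.comp x
    (((Complex.reCLM.hasFDerivAt).comp x hL).log hre))
  refine ⟨_, h3, fun ξ => ?_, fun ξ => ?_, fun ξ => ?_⟩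
  · have hLξ : ((L ξ).re : ℂ) = L ξ := Complex.ext rfl (by simp [him])
    rw [← add_div, ← hab]
    simp [hx, hLξ]
    ring
  · simp only [ha]; ring
  · simp only [hb]; ring

end WirtingerCalculus

/-! ### Sesquilinear forms along holomorphic maps. -/

section Sesquilinear

variable {p : ℕ} (h : Sesq p)

/-- A sesquilinear form as a continuous real bilinear map. -/
def realBilin : V p →L[ℝ] V p →L[ℝ] ℂ :=
  (LinearMap.mk₂ ℝ (fun u v => h u v) (by simp) (by simp) (by simp)
    (fun c u v => by
      rw [← Complex.coe_smul, map_smulₛₗ]; simp)).toContinuousBilinearMap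

@[simp] theorem realBilin_apply (u v : V p) : realBilin h u v = h u v := rfl

variable {B : Type*} [NormedAddCommGroup B] [NormedSpace ℂ B]

theorem hasWirtingerAt_sesq {F G : B → V p} {F' G' : B →L[ℂ] V p} {x : B}
    (hF : HasFDerivAt F F' x) (hG : HasFDerivAt G G' x) :
    HasWirtingerAt (fun z => h (F z) (G z)) (fun ξ => h (F' ξ) (G x)) (fun ξ => h (F x) (G' ξ))
      x := by
  refine ⟨_, (realBilin h).hasFDerivAt_of_bilinear (hF.restrictScalars ℝ) (hG.restrictScalars ℝ),
    fun ξ => ?_, fun ξ => ?_, fun ξ => ?_⟩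
  · simp [add_comm]
  · simp
  · simp

end Sesquilinear

/-! ### Hermitian linear algebra and affine charts. -/

section LinearAlgebra

variable {p : ℕ}

theorem HasSignature.conj_symm {h : Sesq p} (hh : HasSignature h) (u v : V p) :
    star (h u v) = h v u := by
  obtain ⟨b, hb⟩ := hh
  have key : ∀ i j, star (h (b i) (b j)) = h (b j) (b i) := by
    intro i j
    rw [hb, hb]
    by_cases hij : i = j
    · subst hij; rcases i with i | i <;> simp
    · simp [hij, Ne.symm hij]
  rw [← b.sum_repr u, ← b.sum_repr v]
  simp only [map_sum, LinearMap.sum_apply, map_smul, map_smulₛₗ, LinearMap.smul_apply, star_sum,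
    smul_eq_mul, star_mul', key, Finset.mul_sum]
  rw [Finset.sum_comm]
  refine Finset.sum_congr rfl fun i _ => Finset.sum_congr rfl fun j _ => ?_
  simp
  ring

theorem HasSignature.im_self {h : Sesq p} (hh : HasSignature h) (u : V p) : (h u u).im = 0 :=
  Complex.conj_eq_iff_im.mp (hh.conj_symm u u)

/-- Non-degeneracy of `h`; this and hermitian symmetry are what the computations draw from the
signature. -/
theorem HasSignature.eq_zero_of_forall {h : Sesq p} (hh : HasSignature h) {u : V p}
    (hu : ∀ v, h u v = 0) : u = 0 := by
  obtain ⟨b, hb⟩ := hh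
  rw [← b.sum_repr u]
  refine Finset.sum_eq_zero fun j _ => ?_
  have h1 := hu (b j)
  rw [← b.sum_repr u] at h1
  simp only [map_sum, LinearMap.sum_apply, map_smul, LinearMap.smul_apply, hb, smul_eq_mul,
    mul_ite, mul_zero, Finset.sum_ite_eq', Finset.mem_univ, if_true] at h1
  rcases mul_eq_zero.mp h1 with h2 | h2
  · rw [h2, zero_smul]
  · rcases j with j | j <;> simp at h2

/-- The hermitian form `h(s, s) h(u, v) - h(u, s) h(s, v)`, which has `s` in its kernel: up to the
factor `h(s, s)`, the form induced by `h` on the orthogonal of `s`. -/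
def gram2 (h : Sesq p) (s : V p) : Sesq p :=
  LinearMap.mk₂'ₛₗ (RingHom.id ℂ) (starRingEnd ℂ) (fun u v => h s s * h u v - h u s * h s v)
    (fun _ _ _ => by simp; ring) (fun _ _ _ => by simp; ring)
    (fun _ _ _ => by simp; ring) (fun _ _ _ => by simp; ring)

theorem gram2_apply (h : Sesq p) (s u v : V p) :
    gram2 h s u v = h s s * h u v - h u s * h s v := rfl

@[simp] theorem gram2_self_left (h : Sesq p) (s v : V p) : gram2 h s s v = 0 := by
  rw [gram2_apply]; ring

@[simp] theorem gram2_self_right (h : Sesq p) (s u : V p) : gram2 h s u s = 0 := by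
  rw [gram2_apply]; ring

@[simp] theorem gram2_smul (h : Sesq p) (c : ℂ) (s u v : V p) :
    gram2 h (c • s) u v = c * star c * gram2 h s u v := by
  simp [gram2_apply]; ring

theorem gram2_conj_symm {h : Sesq p} (hh : HasSignature h) (s u v : V p) :
    star (gram2 h s u v) = gram2 h s v u := by
  simp only [gram2_apply, star_sub, star_mul', hh.conj_symm]; ring

theorem gram2_im_self {h : Sesq p} (hh : HasSignature h) (s u : V p) :
    (gram2 h s u u).im = 0 :=
  Complex.conj_eq_iff_im.mp (gram2_conj_symm hh s u u)

/-- The inclusion of the model of the `i`-th chart as the hyperplane of the vectors with vanishing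
`i`-th coordinate: the differential of `chartSection i`. -/
def chartTangent (i : Fin (p + 3)) : E p →ₗ[ℂ] V p where
  toFun u := i.insertNth (α := fun _ => ℂ) 0 u
  map_add' u v := by ext k; refine Fin.succAboveCases i ?_ ?_ k <;> simp
  map_smul' c u := by ext k; refine Fin.succAboveCases i ?_ ?_ k <;> simp

@[simp] theorem chartTangent_same (i : Fin (p + 3)) (u : E p) : chartTangent i u i = 0 := by
  simp [chartTangent]

@[simp] theorem chartTangent_succAbove (i : Fin (p + 3)) (u : E p) (k : Fin (p + 2)) :
    chartTangent i u (i.succAbove k) = u k := by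
  simp [chartTangent]

@[simp] theorem chartSection_same (i : Fin (p + 3)) (u : E p) : chartSection i u i = 1 := by
  simp [chartSection]

@[simp] theorem chartSection_succAbove (i : Fin (p + 3)) (u : E p) (k : Fin (p + 2)) :
    chartSection i u (i.succAbove k) = u k := by
  simp [chartSection]

theorem chartSection_eq (i : Fin (p + 3)) (w : E p) :
    chartSection i w = chartSection i 0 + chartTangent i w := by
  ext k; refine Fin.succAboveCases i ?_ ?_ k <;> simp

theorem chartSection_ne_zero (i : Fin (p + 3)) (w : E p) : chartSection i w ≠ 0 := fun h => by
  simpa using congrFun h i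

theorem hasFDerivAt_chartSection (i : Fin (p + 3)) (w : E p) :
    HasFDerivAt (chartSection i) (chartTangent i).toContinuousLinearMap w := by
  have h1 := ((chartTangent i).toContinuousLinearMap.hasFDerivAt (x := w)).const_add
    (chartSection i 0)
  exact h1.congr_of_eventuallyEq (.of_forall fun w => chartSection_eq i w)

theorem continuous_chartSection (i : Fin (p + 3)) : Continuous (chartSection (p := p) i) :=
  continuous_iff_continuousAt.mpr fun w => (hasFDerivAt_chartSection i w).continuousAt

theorem continuous_sesq (h : Sesq p) {T : Type*} [TopologicalSpace T] {F G : T → V p}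
    (hF : Continuous F) (hG : Continuous G) : Continuous fun t => h (F t) (G t) := by
  simp only [← realBilin_apply]; fun_prop

theorem isOpen_pos_chart (h : Sesq p) (i : Fin (p + 3)) :
    IsOpen {w : E p | 0 < (h (chartSection i w) (chartSection i w)).re} :=
  isOpen_lt continuous_const (Complex.continuous_re.comp
    (continuous_sesq h (continuous_chartSection i) (continuous_chartSection i)))

theorem herm_eq_sum {ι : Type*} [Fintype ι] (M : Matrix ι ι ℂ) (u v : ι → ℂ) :
    herm M u v = ∑ j, ∑ k, u j * (M j k * star (v k)) := by
  simp [herm, dotProduct, Matrix.mulVec, Finset.mul_sum]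

theorem chartTangent_eq_sum (i : Fin (p + 3)) (u : E p) :
    chartTangent i u = ∑ j, u j • chartTangent i (Pi.single j 1) := by
  conv_lhs => rw [pi_eq_sum_univ' u]
  simp [map_sum]

theorem sesq_chartTangent (Q : Sesq p) (i : Fin (p + 3)) (u v : E p) :
    Q (chartTangent i u) (chartTangent i v) =
      herm (Matrix.of fun j k => Q (chartTangent i (Pi.single j 1)) (chartTangent i (Pi.single k 1)))
        u v := by
  rw [herm_eq_sum, chartTangent_eq_sum i u, chartTangent_eq_sum i v]
  simp only [map_sum, LinearMap.sum_apply, map_smul, map_smulₛₗ, LinearMap.smul_apply, smul_eq_mul,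
    Matrix.of_apply, Finset.mul_sum]
  rw [Finset.sum_comm]
  refine Finset.sum_congr rfl fun i _ => Finset.sum_congr rfl fun j _ => ?_
  simp
  ring

end LinearAlgebra

/-! ### The metric ω, its Chern connection and its curvature. -/

section Metric

variable {p : ℕ} {h : Sesq p} {i : Fin (p + 3)}

theorem ne_zero_of_re_pos {z : ℂ} (hz : 0 < z.re) : z ≠ 0 := fun h => by simp [h] at hz

/-- The chart section is affine in `w`, so ∂̄_k log h(s,s) = h(s,e_k)/h(s,s) with e_k constant, and
the quotient rule produces the numerator of `gram2`. -/
theorem gram_apply (hh : HasSignature h) {w : E p}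
    (hw : 0 < (h (chartSection i w) (chartSection i w)).re) (j k : Fin (p + 2)) :
    gram h i w j k = -2 * (gram2 h (chartSection i w) (chartTangent i (Pi.single j 1))
      (chartTangent i (Pi.single k 1)) / h (chartSection i w) (chartSection i w) ^ 2) := by
  have hs := fun w => hasFDerivAt_chartSection (p := p) i w
  have h1 : ∀ w, 0 < (h (chartSection i w) (chartSection i w)).re →
      dWbar (fun w'' => (Real.log (h (chartSection i w'') (chartSection i w'')).re : ℂ)) w
        (Pi.single k 1) = h (chartSection i w) (chartTangent i (Pi.single k 1)) /
          h (chartSection i w) (chartSection i w) := fun w hw =>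
    (((hasWirtingerAt_sesq h (hs w) (hs w)).log_re (ne_zero_of_re_pos hw)
      (.of_forall fun _ => hh.im_self _)).dWbar_eq _)
  have h2 := ((hasWirtingerAt_sesq h (hs w) (hasFDerivAt_const
    (chartTangent i (Pi.single k 1)) w)).div (hasWirtingerAt_sesq h (hs w) (hs w))
      (ne_zero_of_re_pos hw)).congr
    (((isOpen_pos_chart h i).eventually_mem hw).mono h1)
  rw [gram, Matrix.of_apply, h2.dW_eq, gram2_apply]
  simp
  ring

theorem gram_eq (hh : HasSignature h) {w : E p}
    (hw : 0 < (h (chartSection i w) (chartSection i w)).re) :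
    gram h i w = Matrix.of fun j k => -2 * (gram2 h (chartSection i w)
      (chartTangent i (Pi.single j 1)) (chartTangent i (Pi.single k 1)) /
        h (chartSection i w) (chartSection i w) ^ 2) :=
  Matrix.ext fun j k => gram_apply hh hw j k

theorem herm_gram (hh : HasSignature h) {w : E p}
    (hw : 0 < (h (chartSection i w) (chartSection i w)).re) (u v : E p) :
    herm (gram h i w) u v = -2 * (gram2 h (chartSection i w) (chartTangent i u)
      (chartTangent i v) / h (chartSection i w) (chartSection i w) ^ 2) := by
  rw [sesq_chartTangent, gram_eq hh hw, herm_eq_sum, herm_eq_sum]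
  simp only [Matrix.of_apply, Finset.sum_div, Finset.mul_sum]
  refine Finset.sum_congr rfl fun i _ => Finset.sum_congr rfl fun j _ => ?_
  ring

/-- A kernel vector u is `gram2`-orthogonal to tangent vectors and to s, hence to all of `V p`.
Non-degeneracy of `h` then gives h(s,s)u = h(u,s)s; the `i`-th coordinate is 0 on the left and
h(u,s) on the right, so u = 0. -/
theorem isUnit_det_gram (hh : HasSignature h) {w : E p}
    (hw : 0 < (h (chartSection i w) (chartSection i w)).re) : IsUnit (gram h i w).det := by
  rw [isUnit_iff_ne_zero]
  intro hdet
  obtain ⟨u, hu0, hu⟩ := Matrix.exists_vecMul_eq_zero_iff.mpr hdet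
  set s := chartSection i w with hs
  have hN : h s s ≠ 0 := ne_zero_of_re_pos hw
  have h1 : ∀ v, gram2 h s (chartTangent i u) (chartTangent i v) = 0 := by
    intro v
    have h2 : herm (gram h i w) u v = 0 := by
      rw [herm, Matrix.dotProduct_mulVec, hu, zero_dotProduct]
    rw [herm_gram hh hw] at h2
    simpa [← hs, hN] using h2
  have h3 : ∀ v, gram2 h s (chartTangent i u) v = 0 := by
    intro v
    have h4 : v = v i • s + chartTangent i (fun k => v (i.succAbove k) - v i * w k) := by
      ext k; refine Fin.succAboveCases i ?_ ?_ k <;> simp [hs]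
    rw [h4, map_add, map_smulₛₗ, h1, gram2_self_right]
    simp
  have h5 : h s s • chartTangent i u - h (chartTangent i u) s • s = 0 :=
    hh.eq_zero_of_forall fun v => by
      rw [← h3 v, gram2_apply]; simp
  have h6 : h (chartTangent i u) s = 0 := by simpa [hs] using congrFun h5 i
  rw [h6, zero_smul, sub_zero, smul_eq_zero_iff_right hN] at h5
  exact hu0 (funext fun k => by simpa using congrFun h5 (i.succAbove k))

/-- The form `∂ log h(s, s)` of the chart, evaluated on the tangent vector `u`. -/
def connForm (h : Sesq p) (i : Fin (p + 3)) (w u : E p) : ℂ :=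
  h (chartTangent i u) (chartSection i w) / h (chartSection i w) (chartSection i w)

/-- The connection matrix of the Chern connection of `ω` evaluated on `ξ`:
`∇_ξ u = -a(u) ξ - a(ξ) u` for constant `u`, with `a = ∂ log h(s, s)`. -/
def connMatrix (h : Sesq p) (i : Fin (p + 3)) (w ξ : E p) : Matrix (Fin (p + 2)) (Fin (p + 2)) ℂ :=
  Matrix.of fun j k => -(connForm h i w (Pi.single j 1) * ξ k) -
    connForm h i w ξ * (1 : Matrix (Fin (p + 2)) (Fin (p + 2)) ℂ) j k

theorem connForm_eq_sum (w u : E p) :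
    connForm h i w u = ∑ j, u j * connForm h i w (Pi.single j 1) := by
  simp only [connForm]
  conv_lhs => rw [chartTangent_eq_sum i u]
  simp only [map_sum, LinearMap.sum_apply, map_smul, LinearMap.smul_apply, smul_eq_mul,
    Finset.sum_div, mul_div_assoc]

theorem vecMul_connMatrix (w ξ u : E p) :
    Matrix.vecMul u (connMatrix h i w ξ) = -(connForm h i w u • ξ) - connForm h i w ξ • u := by
  ext k
  rw [connForm_eq_sum w u]
  simp only [Matrix.vecMul, dotProduct, connMatrix, Matrix.of_apply, mul_sub,
    Finset.sum_sub_distrib, Pi.sub_apply, Pi.neg_apply, Pi.smul_apply, smul_eq_mul,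
    Finset.sum_mul, mul_neg, Finset.sum_neg_distrib]
  congr 1
  · congr 1
    exact Finset.sum_congr rfl fun j _ => by ring
  · simp [Matrix.one_apply]
    ring

variable {B : Type*} [NormedAddCommGroup B] [NormedSpace ℂ B]

/-- The identity A = ∂H · H⁻¹ is checked below in the form A · H = ∂H, of which this is the left
side. -/
theorem connMatrix_mul_gram (hh : HasSignature h) {w : E p}
    (hw : 0 < (h (chartSection i w) (chartSection i w)).re) (ξ : E p) (j k : Fin (p + 2)) :
    (connMatrix h i w ξ * gram h i w) j k = -connForm h i w (Pi.single j 1) *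
      herm (gram h i w) ξ (Pi.single k 1) - connForm h i w ξ * gram h i w j k := by
  have h1 : (connMatrix h i w ξ * gram h i w) j k =
      herm (gram h i w) (Matrix.vecMul (Pi.single j 1) (connMatrix h i w ξ)) (Pi.single k 1) := by
    have : star (Pi.single k (1 : ℂ) : E p) = Pi.single k 1 := by
      ext l; by_cases hl : l = k
      · subst hl; simp
      · simp [hl]
    rw [herm, this, Matrix.single_one_vecMul, Matrix.mulVec_single_one]
    rfl
  have h2 : herm (gram h i w) (Pi.single j 1) (Pi.single k 1) = gram h i w j k := by
    rw [herm_gram hh hw, gram_apply hh hw]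
  rw [h1, vecMul_connMatrix, herm, sub_dotProduct, neg_dotProduct, smul_dotProduct,
    smul_dotProduct, ← herm, ← herm, h2]
  simp

/-- Composition with a holomorphic `φ` serves both uses: `φ = id` for the curvature, a curve for the
connection of f^*T_Ω. -/
theorem chernForm_gram_comp (hh : HasSignature h) {φ : B → E p} {φ' : B →L[ℂ] E p} {b : B}
    (hφ : HasFDerivAt φ φ' b) (hw : 0 < (h (chartSection i (φ b)) (chartSection i (φ b))).re)
    (ξ : B) : chernForm (fun b => gram h i (φ b)) b ξ = connMatrix h i (φ b) (φ' ξ) := by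
  have hs := (hasFDerivAt_chartSection i (φ b)).comp b hφ
  have hN := ne_zero_of_re_pos hw
  have hev : ∀ᶠ b' in 𝓝 b, 0 < (h (chartSection i (φ b')) (chartSection i (φ b'))).re :=
    hφ.continuousAt.eventually ((isOpen_pos_chart h i).eventually_mem hw)
  have key : Matrix.of (fun j k => dW (fun b' => gram h i (φ b') j k) b ξ) =
      connMatrix h i (φ b) (φ' ξ) * gram h i (φ b) := by
    ext j k
    have hj := hasFDerivAt_const (𝕜 := ℂ) (chartTangent i (Pi.single j 1)) b
    have hk := hasFDerivAt_const (𝕜 := ℂ) (chartTangent i (Pi.single k 1)) b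
    have hNN := hasWirtingerAt_sesq h hs hs
    have h1 := ((hasWirtingerAt_const (x := b) (-2)).mul
      (((hNN.mul (hasWirtingerAt_sesq h hj hk)).sub
      ((hasWirtingerAt_sesq h hj hs).mul (hasWirtingerAt_sesq h hs hk))).div (hNN.mul hNN)
      (mul_ne_zero hN hN))).congr (G := fun b' => gram h i (φ b') j k) (by
        filter_upwards [hev] with b' hb'
        rw [gram_apply hh hb', gram2_apply, pow_two]
        rfl)
    rw [Matrix.of_apply, h1.dW_eq, connMatrix_mul_gram hh hw, gram_apply hh hw, herm_gram hh hw,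
      gram2_apply, gram2_apply, connForm, connForm]
    simp only [Function.comp, ContinuousLinearMap.comp_apply, LinearMap.coe_toContinuousLinearMap',
      zero_apply, map_zero, LinearMap.zero_apply]
    field_simp
    ring
  rw [chernForm, key, Matrix.mul_assoc, Matrix.mul_nonsing_inv _ (isUnit_det_gram hh hw),
    Matrix.mul_one]

theorem chernForm_gram (hh : HasSignature h) {w : E p}
    (hw : 0 < (h (chartSection i w) (chartSection i w)).re) (ξ : E p) :
    chernForm (gram h i) w ξ = connMatrix h i w ξ :=
  chernForm_gram_comp hh (hasFDerivAt_id w) hw ξ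

/-- Since a = ∂ log h(s,s), its ∂̄-part is ∂̄∂ log h(s,s) = -ω/2. -/
theorem hasWirtingerAt_connForm (hh : HasSignature h) {w : E p}
    (hw : 0 < (h (chartSection i w) (chartSection i w)).re) (u : E p) :
    HasWirtingerAt (fun w => connForm h i w u)
      (fun ξ => -(connForm h i w u * connForm h i w ξ))
      (fun η => -(herm (gram h i w) u η / 2)) w := by
  have hs := hasFDerivAt_chartSection (p := p) i w
  have hN := ne_zero_of_re_pos hw
  refine ((hasWirtingerAt_sesq h (hasFDerivAt_const (chartTangent i u) w) hs).div
    (hasWirtingerAt_sesq h hs hs) hN).congr_deriv (fun ξ => ?_) fun η => ?_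
  · simp [connForm]; field_simp
  · rw [herm_gram hh hw, gram2_apply]
    simp
    ring

/-- The connection matrix is linear in a, so its ∂̄ only involves ∂̄a = -ω/2. -/
theorem chernCurvature_gram (hh : HasSignature h) {w : E p}
    (hw : 0 < (h (chartSection i w) (chartSection i w)).re) (ξ η u : E p) :
    chernCurvature (gram h i) w ξ η u = -(herm (gram h i w) u η / 2) • ξ -
      (herm (gram h i w) ξ η / 2) • u := by
  have hev : ∀ᶠ w in 𝓝 w, 0 < (h (chartSection i w) (chartSection i w)).re :=
    (isOpen_pos_chart h i).eventually_mem hw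
  have h1 : ∀ j k, -dWbar (fun w => chernForm (gram h i) w ξ j k) w η =
      -(herm (gram h i w) (Pi.single j 1) η / 2 * ξ k) -
        herm (gram h i w) ξ η / 2 * (1 : Matrix (Fin (p + 2)) (Fin (p + 2)) ℂ) j k := by
    intro j k
    have h2 := (((hasWirtingerAt_const (x := w) 0).sub ((hasWirtingerAt_connForm hh hw (Pi.single j 1)).mul
      (hasWirtingerAt_const (ξ k)))).sub ((hasWirtingerAt_connForm hh hw ξ).mul (hasWirtingerAt_const
        ((1 : Matrix (Fin (p + 2)) (Fin (p + 2)) ℂ) j k)))).congr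
          (G := fun w => chernForm (gram h i) w ξ j k) (by
        filter_upwards [hev] with w hw
        rw [chernForm_gram hh hw, connMatrix, Matrix.of_apply]
        ring)
    rw [h2.dWbar_eq]
    ring
  have h3 : herm (gram h i w) u η = ∑ j, u j * herm (gram h i w) (Pi.single j 1) η := by
    simp only [herm, single_one_dotProduct]
    rfl
  ext k
  simp only [chernCurvature, h1, Matrix.vecMul, dotProduct, Matrix.of_apply, mul_sub,
    Finset.sum_sub_distrib, Pi.sub_apply, Pi.smul_apply, smul_eq_mul, h3, mul_neg,
    Finset.sum_neg_distrib, Finset.sum_div, Finset.sum_mul, neg_mul]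
  congr 1
  · congr 1
    exact Finset.sum_congr rfl fun j _ => by ring
  · simp [Matrix.one_apply]
    ring

/-- The holomorphic sectional curvature of `ω` is `-1` on the non-isotropic directions. -/
theorem holSecCurv_eq (hh : HasSignature h) {w : E p}
    (hw : 0 < (h (chartSection i w) (chartSection i w)).re) {u : E p}
    (hu : herm (gram h i w) u u ≠ 0) : holSecCurv h i w u = -1 := by
  rw [holSecCurv, chernCurvature_gram hh hw]
  set g := gram h i w
  have h1 : herm g (-(herm g u u / 2) • u - (herm g u u / 2) • u) u = -herm g u u ^ 2 := by
    conv_lhs => rw [herm]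
    rw [sub_dotProduct, smul_dotProduct, smul_dotProduct, ← herm]
    simp only [smul_eq_mul]
    ring
  rw [h1]
  field_simp

end Metric

/-! ### The generator of the extended tangent direction. -/

section TangentGen

variable {W : Type*} [NormedAddCommGroup W] [NormedSpace ℂ W]

theorem dslope_eventuallyEq {g Q : ℂ → W} {x : ℂ} (hQ : DifferentiableAt ℂ Q x)
    (hg : ∀ᶠ z in 𝓝 x, g z = (z - x) • Q z) : dslope g x =ᶠ[𝓝 x] Q := by
  have hgx : g x = 0 := by simpa using hg.self_of_nhds
  filter_upwards [hg] with z hz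
  rcases eq_or_ne z x with rfl | hzx
  · rw [dslope_same]
    have h1 := (((hasDerivAt_id z).sub_const z).smul hQ.hasDerivAt).congr_of_eventuallyEq hg
    rw [h1.deriv]
    simp
  · rw [dslope_of_ne _ hzx, slope_def_module, hgx, sub_zero, hz, smul_smul,
      inv_mul_cancel₀ (sub_ne_zero.mpr hzx), one_smul]

theorem iterate_dslope_eventuallyEq {X : ℂ → W} {x : ℂ} (hX : DifferentiableAt ℂ X x) (k : ℕ) :
    ∀ {g : ℂ → W}, (∀ᶠ z in 𝓝 x, g z = (z - x) ^ k • X z) →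
      (Function.swap dslope x)^[k] g =ᶠ[𝓝 x] X := by
  induction k with
  | zero => intro g hg; exact hg.mono fun z hz => by simpa using hz
  | succ k ih =>
    intro g hg
    rw [Function.iterate_succ_apply]
    refine ih (dslope_eventuallyEq (by fun_prop) ?_)
    filter_upwards [hg] with z hz
    rw [hz, smul_smul, pow_succ']

/-- Each `dslope` strips one factor z - x, and the order of vanishing is exactly `k`. Any such
factorisation therefore computes `tangentGen`. -/
theorem tangentGen_eventuallyEq {c X : ℂ → W} {x : ℂ} {k : ℕ} (hX : AnalyticAt ℂ X x)
    (h0 : X x ≠ 0) (hc : ∀ᶠ z in 𝓝 x, deriv c z = (z - x) ^ k • X z) :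
    tangentGen c x =ᶠ[𝓝 x] X := by
  have han : AnalyticAt ℂ (deriv c) x :=
    AnalyticAt.congr (f := fun z => (z - x) ^ k • X z) (by fun_prop) (hc.mono fun z hz => hz.symm)
  have hord : analyticOrderAt (deriv c) x = k :=
    han.analyticOrderAt_eq_natCast.mpr ⟨X, hX, h0, hc⟩
  rw [tangentGen, analyticOrderNatAt, hord]
  exact iterate_dslope_eventuallyEq hX.differentiableAt k hc

theorem tangentGen_spec [CompleteSpace W] {c : ℂ → W} {x : ℂ} (hc : AnalyticAt ℂ c x)
    (h0 : tangentGen c x x ≠ 0) : AnalyticAt ℂ (tangentGen c x) x ∧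
      ∃ k : ℕ, ∀ᶠ z in 𝓝 x, deriv c z = (z - x) ^ k • tangentGen c x z := by
  have hord : analyticOrderAt (deriv c) x ≠ ⊤ := by
    intro htop
    apply h0
    -- An infinite order becomes `0` as a natural number, so `tangentGen c x` is `deriv c`, which
    -- vanishes at `x`.
    rw [tangentGen, analyticOrderNatAt, htop]
    exact (analyticOrderAt_eq_top.mp htop).self_of_nhds
  obtain ⟨X, hX, hX0, hcX⟩ := hc.deriv.analyticOrderAt_ne_top.mp hord
  have h1 := tangentGen_eventuallyEq hX hX0 hcX
  refine ⟨hX.congr h1.symm, analyticOrderNatAt (deriv c) x, ?_⟩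
  filter_upwards [h1, hcX] with z hz hz'
  rw [hz, hz']

end TangentGen

/-! ### The second fundamental form as a quotient of Gram determinants. -/

section Sigma

variable {p : ℕ} {h : Sesq p}

/-- The squared norm of the second fundamental form of the line spanned by `X`, in terms of
homogeneous coordinates `s` of the base point, `X` and the derivative `W` of `X`. -/
def frameSigma (h : Sesq p) (s X W : V p) : ℂ :=
  (gram2 h s W W * gram2 h s X X - gram2 h s W X * gram2 h s X W) / gram2 h s X X ^ 2

/-- Multiples of s lie in the kernel of `gram2`, and adding a multiple of X to W does not change a
Gram determinant. Numerator and denominator both scale by |l|⁴|b|⁴; if `gram2 h s X X = 0`, both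
sides are divisions by zero, hence 0. -/
theorem frameSigma_change (s X W : V p) {l b : ℂ} (hl : l ≠ 0) (hb : b ≠ 0) (γ κ μ : ℂ) :
    frameSigma h (l • s) (b • X + γ • s) (b • W + κ • X + μ • s) = frameSigma h s X W := by
  have hl' : star l ≠ 0 := star_ne_zero.mpr hl
  have hb' : star b ≠ 0 := star_ne_zero.mpr hb
  simp only [frameSigma, gram2_smul, map_add, LinearMap.add_apply, map_smul, LinearMap.smul_apply,
    map_smulₛₗ, gram2_self_left, gram2_self_right, smul_eq_mul, mul_zero, add_zero,
    starRingEnd_apply]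
  by_cases h0 : gram2 h s X X = 0
  · simp [h0]
  · field_simp
    ring

theorem frameSigma_smul_right (s X W : V p) (c : ℂ) :
    frameSigma h s X (c • W) = c * star c * frameSigma h s X W := by
  simp only [frameSigma, map_smul, LinearMap.smul_apply, map_smulₛₗ, smul_eq_mul,
    starRingEnd_apply]
  ring

theorem sigma_chart (hh : HasSignature h) {i : Fin (p + 3)} {φ : ℂ → E p} {x β : ℂ} {X : ℂ → E p}
    (hφ : HasDerivAt φ (β • X x) x)
    (hw : 0 < (h (chartSection i (φ x)) (chartSection i (φ x))).re)
    (h0 : herm (gram h i (φ x)) (X x) (X x) ≠ 0) :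
    (herm (gram h i (φ x))
        (projOrth (gram h i (φ x)) (X x) (covDeriv (fun z => gram h i (φ z)) X x))
        (projOrth (gram h i (φ x)) (X x) (covDeriv (fun z => gram h i (φ z)) X x))).re /
      (herm (gram h i (φ x)) (X x) (X x)).re =
    (frameSigma h (chartSection i (φ x)) (chartTangent i (X x))
      (chartTangent i (deriv X x))).re := by
  have hN := ne_zero_of_re_pos hw
  -- Both terms of -a(X)φ' - a(φ')X are multiples of X because φ' = βX; the projection removes them.
  obtain ⟨κ, hκ⟩ : ∃ κ : ℂ, covDeriv (fun z => gram h i (φ z)) X x = deriv X x + κ • X x := by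
    refine ⟨-(connForm h i (φ x) (X x) * β) - connForm h i (φ x) (β • X x), ?_⟩
    rw [covDeriv, chernForm_gram_comp hh hφ.hasFDerivAt hw, vecMul_connMatrix]
    simp only [ContinuousLinearMap.toSpanSingleton_apply, one_smul]
    module
  have hG := herm_gram hh hw
  set s := chartSection i (φ x)
  set u := chartTangent i (X x) with hu
  set v := chartTangent i (deriv X x) with hv
  have hg : gram2 h s u u ≠ 0 := by
    rw [hG] at h0
    exact fun h1 => h0 (by rw [h1]; simp)
  have hψ : projOrth (gram h i (φ x)) (X x) (covDeriv (fun z => gram h i (φ z)) X x) =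
      deriv X x - (gram2 h s v u / gram2 h s u u) • X x := by
    rw [projOrth, hκ, hG, hG, map_add, map_smul, ← hu, ← hv]
    have : -2 * (gram2 h s (v + κ • u) u / h s s ^ 2) / (-2 * (gram2 h s u u / h s s ^ 2)) =
        gram2 h s v u / gram2 h s u u + κ := by
      simp only [map_add, map_smul, LinearMap.add_apply, LinearMap.smul_apply, smul_eq_mul]
      field_simp
    rw [this]
    module
  have hreal : star (gram2 h s u u) = gram2 h s u u := gram2_conj_symm hh s u u
  have hre : ∀ w : E p, (herm (gram h i (φ x)) w w).im = 0 := fun w => by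
    apply Complex.conj_eq_iff_im.mp
    have h1 := gram2_conj_symm hh s (chartTangent i w) (chartTangent i w)
    have h2 := hh.conj_symm s s
    rw [← starRingEnd_apply] at h1 h2
    rw [hG, map_mul, map_div₀, map_pow, h1, h2, map_neg, map_ofNat]
  have hdiv : ∀ {a b : ℂ}, a.im = 0 → b.im = 0 → a.re / b.re = (a / b).re := by
    intro a b ha hb
    have ha' : ((a.re : ℝ) : ℂ) = a := Complex.ext rfl (by simp [ha])
    have hb' : ((b.re : ℝ) : ℂ) = b := Complex.ext rfl (by simp [hb])
    rw [← Complex.ofReal_re (a.re / b.re), Complex.ofReal_div, ha', hb']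
  rw [hdiv (hre _) (hre _), hψ, hG, hG]
  congr 1
  simp only [map_sub, map_smul, ← hu, ← hv, LinearMap.sub_apply, LinearMap.smul_apply, map_smulₛₗ,
    smul_eq_mul, map_div₀, starRingEnd_apply, gram2_conj_symm hh, frameSigma]
  field_simp
  ring

end Sigma

/-! ### Holomorphic lifts of a curve and independence of the chart. -/

section Charts

variable {p : ℕ}

theorem coord_mk (i : Fin (p + 3)) {v : V p} (hv : v ≠ 0) (k : Fin (p + 2)) :
    coord i (Projectivization.mk ℂ v hv) k = v (i.succAbove k) / v i := by
  obtain ⟨a, ha⟩ := Projectivization.exists_smul_eq_mk_rep ℂ v hv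
  rw [coord, ← ha]
  simp only [Pi.smul_apply, Units.smul_def, smul_eq_mul]
  exact mul_div_mul_left _ _ a.ne_zero

theorem inChart_mk (i : Fin (p + 3)) {v : V p} (hv : v ≠ 0) :
    InChart i (Projectivization.mk ℂ v hv) ↔ v i ≠ 0 := by
  obtain ⟨a, ha⟩ := Projectivization.exists_smul_eq_mk_rep ℂ v hv
  rw [InChart, ← ha]
  simp [Units.smul_def]

theorem inChart_chartAt (l : Projectivization ℂ (V p)) : InChart (chartAt l) l :=
  (exists_inChart l).choose_spec

theorem chartSection_coord {i : Fin (p + 3)} {l : Projectivization ℂ (V p)} (hl : InChart i l) :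
    Projectivization.mk ℂ (chartSection i (coord i l)) (chartSection_ne_zero _ _) = l := by
  conv_rhs => rw [← l.mk_rep]
  rw [Projectivization.mk_eq_mk_iff']
  refine ⟨(l.rep i)⁻¹, ?_⟩
  have : l.rep i ≠ 0 := hl
  ext k
  refine Fin.succAboveCases i ?_ ?_ k
  · simp [this]
  · intro k
    simp [coord]
    ring

theorem mk_mem_Omega {h : Sesq p} {v : V p} {hv : v ≠ 0}
    (hl : Projectivization.mk ℂ v hv ∈ Omega h) : 0 < (h v v).re :=
  hl v (by rw [Projectivization.submodule_mk]; exact Submodule.mem_span_singleton_self v) hv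

theorem pos_chartSection {h : Sesq p} {i : Fin (p + 3)} {l : Projectivization ℂ (V p)}
    (hl : InChart i l) (hΩ : l ∈ Omega h) :
    0 < (h (chartSection i (coord i l)) (chartSection i (coord i l))).re := by
  rw [← chartSection_coord hl] at hΩ
  exact mk_mem_Omega hΩ

/-- `F` is a holomorphic lift to `ℂ^(3+p)` of the curve `f` near `x`, and `F' = (z - x)^k Y` with `Y`
holomorphic. -/
structure IsFrame (f : ℂ → Projectivization ℂ (V p)) (F Y : ℂ → V p) (k : ℕ) (x : ℂ) : Prop where
  analytic_lift : AnalyticAt ℂ F x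
  analytic_gen : AnalyticAt ℂ Y x
  lift : ∀ᶠ z in 𝓝 x, ∃ hz : F z ≠ 0, f z = Projectivization.mk ℂ (F z) hz
  deriv_lift : ∀ᶠ z in 𝓝 x, deriv F z = (z - x) ^ k • Y z

variable {f : ℂ → Projectivization ℂ (V p)} {F Y : ℂ → V p} {k : ℕ} {x : ℂ} {i : Fin (p + 3)}

/-- The tangent vector field of the `i`-th chart induced by a frame. -/
def chartGen (i : Fin (p + 3)) (F Y : ℂ → V p) (z : ℂ) : E p := fun l =>
  (Y z (i.succAbove l) * F z i - F z (i.succAbove l) * Y z i) / F z i ^ 2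

theorem chartTangent_chartGen {z : ℂ} (hz : F z i ≠ 0) :
    chartTangent i (chartGen i F Y z) = (F z i)⁻¹ • Y z + (-Y z i / F z i ^ 2) • F z := by
  ext l
  refine Fin.succAboveCases i ?_ ?_ l
  · simp; field_simp; simp
  · intro l
    simp [chartGen]; field_simp; ring

theorem IsFrame.eventually_ne (hf : IsFrame f F Y k x) (hi : InChart i (f x)) :
    ∀ᶠ z in 𝓝 x, F z i ≠ 0 := by
  obtain ⟨hz, hfx⟩ := hf.lift.self_of_nhds
  rw [hfx, inChart_mk] at hi
  exact (continuousAt_pi.mp hf.analytic_lift.continuousAt i).eventually_ne hi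

theorem IsFrame.inCoord_eventuallyEq (hf : IsFrame f F Y k x) :
    inCoord i f =ᶠ[𝓝 x] fun z l => F z (i.succAbove l) / F z i := by
  filter_upwards [hf.lift] with z hz
  obtain ⟨hz, hfz⟩ := hz
  ext l
  rw [inCoord, hfz, coord_mk]

theorem IsFrame.chartSection_inCoord (hf : IsFrame f F Y k x) (hi : InChart i (f x)) :
    chartSection i (inCoord i f x) = (F x i)⁻¹ • F x := by
  have hne := (hf.eventually_ne hi).self_of_nhds
  rw [(hf.inCoord_eventuallyEq (i := i)).self_of_nhds]
  ext l
  refine Fin.succAboveCases i ?_ ?_ l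
  · simp [hne]
  · intro l
    simp
    ring

theorem IsFrame.hasDerivAt_inCoord (hf : IsFrame f F Y k x) (hi : InChart i (f x)) :
    ∀ᶠ z in 𝓝 x, HasDerivAt (inCoord i f) ((z - x) ^ k • chartGen i F Y z) z := by
  filter_upwards [(hf.inCoord_eventuallyEq (i := i)).eventually_nhds, hf.eventually_ne hi,
    hf.analytic_lift.eventually_analyticAt, hf.deriv_lift] with z hz hne han hd
  refine HasDerivAt.congr_of_eventuallyEq ?_ hz
  rw [hasDerivAt_pi]
  intro l
  have h1 := hasDerivAt_pi.mp (han.differentiableAt.hasDerivAt)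
  have h2 := (h1 (i.succAbove l)).div (h1 i) hne
  refine h2.congr_deriv ?_
  simp only [hd, Pi.smul_apply, smul_eq_mul, chartGen]
  ring

theorem IsFrame.analyticAt_chartGen (hf : IsFrame f F Y k x) (hi : InChart i (f x)) :
    AnalyticAt ℂ (chartGen i F Y) x := by
  have hne := (hf.eventually_ne hi).self_of_nhds
  have hF := analyticAt_pi_iff.mp hf.analytic_lift
  have hY := analyticAt_pi_iff.mp hf.analytic_gen
  exact analyticAt_pi_iff.mpr fun l =>
    (((hY _).mul (hF _)).sub ((hF _).mul (hY _))).div ((hF _).pow 2) (pow_ne_zero 2 hne)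

/-- `chartGen` could vanish at `x` only if Y(x) were a multiple of F(x), that is, zero in the
tangent space. -/
theorem IsFrame.tangentGen_inCoord (hf : IsFrame f F Y k x) (hi : InChart i (f x))
    (hind : ∀ c : ℂ, Y x ≠ c • F x) :
    tangentGen (inCoord i f) x =ᶠ[𝓝 x] chartGen i F Y := by
  have hne := (hf.eventually_ne hi).self_of_nhds
  refine tangentGen_eventuallyEq (k := k) (hf.analyticAt_chartGen hi) (fun h0 => ?_)
    ((hf.hasDerivAt_inCoord hi).mono fun z hz => hz.deriv)
  have h1 := chartTangent_chartGen (Y := Y) hne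
  rw [h0, map_zero] at h1
  apply hind (Y x i / F x i)
  have h2 : (F x i) • ((F x i)⁻¹ • Y x + (-Y x i / F x i ^ 2) • F x) = 0 := by
    rw [← h1, smul_zero]
  rw [smul_add, smul_smul, smul_smul, mul_inv_cancel₀ hne, one_smul, ← eq_neg_iff_add_eq_zero,
    ← neg_smul] at h2
  refine h2.trans (congrArg (· • F x) ?_)
  field_simp

/-- The Leibniz term containing F' is again a multiple of Y, so the chart only adds terms that
`frameSigma_change` ignores. -/
theorem IsFrame.chartTangent_deriv_chartGen (hf : IsFrame f F Y k x) (hi : InChart i (f x)) :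
    ∃ κ μ : ℂ, chartTangent i (deriv (chartGen i F Y) x) =
      (F x i)⁻¹ • deriv Y x + κ • Y x + μ • F x := by
  have hne := (hf.eventually_ne hi).self_of_nhds
  have hF := hf.analytic_lift.differentiableAt
  have hY := hf.analytic_gen.differentiableAt
  have hFi := differentiableAt_pi.mp hF i
  have hYi := differentiableAt_pi.mp hY i
  have hl : DifferentiableAt ℂ (fun z => (F z i)⁻¹) x := hFi.fun_inv hne
  have hg : DifferentiableAt ℂ (fun z => -Y z i / F z i ^ 2) x :=
    hYi.neg.div (hFi.pow 2) (pow_ne_zero 2 hne)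
  have h1 : HasDerivAt (fun z => chartTangent i (chartGen i F Y z))
      (chartTangent i (deriv (chartGen i F Y) x)) x :=
    (chartTangent i).toContinuousLinearMap.hasFDerivAt.comp_hasDerivAt x
      (hf.analyticAt_chartGen hi).differentiableAt.hasDerivAt
  have h2 := ((hl.hasDerivAt.smul hY.hasDerivAt).add
    (hg.hasDerivAt.smul hF.hasDerivAt)).congr_of_eventuallyEq
      ((hf.eventually_ne hi).mono fun z hz => chartTangent_chartGen (Y := Y) hz)
  rw [h1.unique h2, hf.deriv_lift.self_of_nhds]
  refine ⟨deriv (fun z => (F z i)⁻¹) x + (-Y x i / F x i ^ 2) * (x - x) ^ k,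
    deriv (fun z => -Y z i / F z i ^ 2) x, ?_⟩
  module

variable {h : Sesq p}

theorem norm_tangent_change (s X : V p) {l : ℂ} (hl : l ≠ 0) (γ : ℂ) :
    gram2 h (l • s) (l • X + γ • s) (l • X + γ • s) / h (l • s) (l • s) ^ 2 =
      gram2 h s X X / h s s ^ 2 := by
  have hl' : star l ≠ 0 := star_ne_zero.mpr hl
  simp only [gram2_smul, map_add, LinearMap.add_apply, map_smul, LinearMap.smul_apply,
    map_smulₛₗ, gram2_self_left, gram2_self_right, smul_eq_mul, mul_zero, add_zero,
    starRingEnd_apply]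
  rw [show (star l * (l * h s s)) ^ 2 = (l * star l) * (l * star l) * h s s ^ 2 by ring,
    show star l * (l * (l * star l * gram2 h s X X)) =
      (l * star l) * (l * star l) * gram2 h s X X by ring]
  exact mul_div_mul_left _ _ (by positivity)

theorem HasSignature.re_norm_tangent (hh : HasSignature h) (s X : V p) :
    (-2 * (gram2 h s X X / h s s ^ 2)).re = -2 * (gram2 h s X X).re / (h s s).re ^ 2 := by
  have h1 : (((h s s).re : ℝ) : ℂ) = h s s := Complex.ext rfl (by simp [hh.im_self])
  have h2 : (((gram2 h s X X).re : ℝ) : ℂ) = gram2 h s X X :=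
    Complex.ext rfl (by simp [gram2_im_self hh])
  rw [show -2 * (gram2 h s X X / h s s ^ 2) =
      ((-2 * (gram2 h s X X).re / (h s s).re ^ 2 : ℝ) : ℂ) by push_cast; rw [h1, h2]; ring]
  exact Complex.ofReal_re _

theorem IsFrame.pos (hf : IsFrame f F Y k x) (hΩ : f x ∈ Omega h) : 0 < (h (F x) (F x)).re := by
  obtain ⟨hz, hfx⟩ := hf.lift.self_of_nhds
  rw [hfx] at hΩ
  exact mk_mem_Omega hΩ

theorem IsFrame.herm_chartGen (hh : HasSignature h) (hf : IsFrame f F Y k x) (hΩ : f x ∈ Omega h)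
    (hi : InChart i (f x)) :
    (herm (gram h i (inCoord i f x)) (chartGen i F Y x) (chartGen i F Y x)).re =
      -2 * (gram2 h (F x) (Y x) (Y x)).re / (h (F x) (F x)).re ^ 2 := by
  have hne := (hf.eventually_ne hi).self_of_nhds
  have hw : 0 < (h (chartSection i (inCoord i f x)) (chartSection i (inCoord i f x))).re :=
    pos_chartSection hi hΩ
  rw [herm_gram hh hw, chartTangent_chartGen hne, hf.chartSection_inCoord hi,
    norm_tangent_change _ _ (inv_ne_zero hne), hh.re_norm_tangent]

theorem IsFrame.positiveAt_iff (hh : HasSignature h) (hf : IsFrame f F Y k x) (hΩ : f x ∈ Omega h)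
    (hind : ∀ c : ℂ, Y x ≠ c • F x) :
    PositiveAt h f x ↔ (gram2 h (F x) (Y x) (Y x)).re < 0 := by
  have hi := inChart_chartAt (f x)
  rw [PositiveAt]
  simp only [(hf.tangentGen_inCoord hi hind).self_of_nhds, hf.herm_chartGen hh hΩ hi]
  have := hf.pos hΩ
  rw [div_pos_iff_of_pos_right (by positivity)]
  constructor <;> intro <;> linarith

/-- With exponent 0, Y is F' itself; it may vanish modulo F at a zero of f'. -/
theorem IsFrame.pullbackDensity_eq (hh : HasSignature h) (hf : IsFrame f F Y 0 x)
    (hΩ : f x ∈ Omega h) : pullbackDensity h f x =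
      -2 * (gram2 h (F x) (Y x) (Y x)).re / (h (F x) (F x)).re ^ 2 := by
  have hi := inChart_chartAt (f x)
  have hφ := (hf.hasDerivAt_inCoord hi).self_of_nhds.deriv
  rw [← hf.herm_chartGen hh hΩ hi, pullbackDensity]
  simp only [hφ, pow_zero, one_smul]

theorem IsFrame.sigmaDensity_eq (hh : HasSignature h) (hf : IsFrame f F Y k x) (hΩ : f x ∈ Omega h)
    (hind : ∀ c : ℂ, Y x ≠ c • F x) (hpos : PositiveAt h f x) :
    sigmaDensity h f x = (frameSigma h (F x) (Y x) (deriv Y x)).re := by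
  have hi := inChart_chartAt (f x)
  have hne := (hf.eventually_ne hi).self_of_nhds
  have hw := pos_chartSection hi hΩ
  have hgen := hf.tangentGen_inCoord hi hind
  have hφ := (hf.hasDerivAt_inCoord hi).self_of_nhds
  rw [← hgen.self_of_nhds] at hφ
  have h1 := sigma_chart hh hφ hw (ne_zero_of_re_pos hpos)
  rw [hgen.self_of_nhds, hgen.deriv_eq, hf.chartSection_inCoord hi, chartTangent_chartGen hne] at h1
  obtain ⟨κ, μ, h2⟩ := hf.chartTangent_deriv_chartGen hi
  rw [h2, frameSigma_change _ _ _ (inv_ne_zero hne) (inv_ne_zero hne)] at h1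
  rw [← h1, ← hgen.self_of_nhds]
  rfl

end Charts

/-! ### ‖ψ‖² in terms of the Demailly–Semple lifts. -/

section SecondLift

variable {p : ℕ} {h : Sesq p} {f : ℂ → Projectivization ℂ (V p)} {x : ℂ} {i : Fin (p + 3)}

theorem HolomorphicNear.exists_isFrame (hf : HolomorphicNear f x) :
    ∃ F, IsFrame f F (deriv F) 0 x := by
  obtain ⟨F, hF, hFf⟩ := hf
  exact ⟨F, hF, hF.deriv, hFf, by simp⟩

theorem HolomorphicNear.analyticAt_inCoord (hf : HolomorphicNear f x) (hi : InChart i (f x)) :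
    AnalyticAt ℂ (inCoord i f) x := by
  obtain ⟨F, hF⟩ := hf.exists_isFrame
  exact Complex.analyticAt_iff_eventually_differentiableAt.mpr
    ((hF.hasDerivAt_inCoord hi).mono fun z hz => hz.differentiableAt)

theorem chartTangent_ne_smul {u w : E p} (hu : u ≠ 0) (c : ℂ) :
    chartTangent i u ≠ c • chartSection i w := by
  intro hc
  have h1 : c = 0 := by simpa using (congrFun hc i).symm
  rw [h1, zero_smul] at hc
  exact hu (funext fun k => by simpa using congrFun hc (i.succAbove k))

theorem HolomorphicNear.isFrame_inCoord (hf : HolomorphicNear f x) (hi : InChart i (f x))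
    (h0 : tangentGen (inCoord i f) x x ≠ 0) :
    ∃ k, IsFrame f (fun z => chartSection i (inCoord i f z))
      (fun z => chartTangent i (tangentGen (inCoord i f) x z)) k x := by
  have hφ := hf.analyticAt_inCoord hi
  obtain ⟨hX, k, hk⟩ := tangentGen_spec hφ h0
  obtain ⟨F, hF⟩ := hf.exists_isFrame
  have hd : ∀ᶠ z in 𝓝 x, HasDerivAt (fun z => chartSection i (inCoord i f z))
      (chartTangent i (deriv (inCoord i f) z)) z := by
    filter_upwards [hφ.eventually_analyticAt] with z hz
    exact (hasFDerivAt_chartSection i _).comp_hasDerivAt z hz.differentiableAt.hasDerivAt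
  refine ⟨k, Complex.analyticAt_iff_eventually_differentiableAt.mpr
    (hd.mono fun z hz => hz.differentiableAt),
    (chartTangent i).toContinuousLinearMap.analyticAt _ |>.comp hX, ?_, ?_⟩
  · filter_upwards [hF.eventually_ne hi, hF.lift] with z hz hfz
    obtain ⟨hFz, hfz⟩ := hfz
    exact ⟨chartSection_ne_zero _ _, (chartSection_coord
      (by rw [hfz]; exact (inChart_mk i hFz).mpr hz)).symm⟩
  · filter_upwards [hk, hd] with z hz hd
    rw [hd.deriv, hz, map_smul]

/-- The density `‖ψ‖²` in terms of the first lift and of its velocity, in any chart. -/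
theorem PositiveGerm.sigmaDensity_eq_lift1 (hh : HasSignature h) (hf : PositiveGerm h f x)
    {j : Fin (p + 2)} (hij : Lift1InChart i j f x) :
    sigmaDensity h f x = (frameSigma h (chartSection i (lift1 i j f x x).1)
      (chartTangent i (j.insertNth (α := fun _ => ℂ) 1 (lift1 i j f x x).2))
      (chartTangent i (j.insertNth (α := fun _ => ℂ) 0 (velocity1 i j f x).2))).re := by
  obtain ⟨hi, hj⟩ := hij
  have h0 : tangentGen (inCoord i f) x x ≠ 0 := fun h0 => hj (by rw [h0]; rfl)
  obtain ⟨k, hfr⟩ := hf.holo.isFrame_inCoord hi h0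
  have hφ := hf.holo.analyticAt_inCoord hi
  obtain ⟨hX, -⟩ := tangentGen_spec hφ h0
  rw [hfr.sigmaDensity_eq hh hf.mem (chartTangent_ne_smul h0) hf.pos]
  set φ := inCoord i f
  set X := tangentGen φ x
  have hX' := hX.differentiableAt.hasDerivAt
  have hXl := hasDerivAt_pi.mp hX'
  have h1 : deriv (fun z => chartTangent i (X z)) x = chartTangent i (deriv X x) :=
    ((chartTangent i).toContinuousLinearMap.hasFDerivAt.comp_hasDerivAt x hX').deriv
  have h2 : HasDerivAt (lift1 i j f x) (deriv φ x, fun l => (deriv X x (j.succAbove l) * X x j -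
      X x (j.succAbove l) * deriv X x j) / X x j ^ 2) x :=
    hφ.differentiableAt.hasDerivAt.prodMk (hasDerivAt_pi.mpr fun l => (hXl _).div (hXl j) hj)
  have hl : lift1 i j f x x = (φ x, fun l => X x (j.succAbove l) / X x j) := rfl
  have hv : velocity1 i j f x = _ := h2.deriv
  set r := (lift1 i j f x x).2
  set r' := (velocity1 i j f x).2
  -- X = X_j·(1, r), hence X' = X_j·(0, r') + X_j'·(1, r). By `frameSigma_change` only (1, r) and
  -- (0, r') matter.
  have h3 : X x = X x j • j.insertNth (α := fun _ => ℂ) 1 r := by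
    ext l
    refine Fin.succAboveCases j ?_ ?_ l
    · simp
    · intro l
      simp only [r, hl, Pi.smul_apply, Fin.insertNth_apply_succAbove, smul_eq_mul]
      field_simp
  have h4 : deriv X x = X x j • j.insertNth (α := fun _ => ℂ) 0 r' +
      deriv X x j • j.insertNth (α := fun _ => ℂ) 1 r := by
    ext l
    refine Fin.succAboveCases j ?_ ?_ l
    · simp
    · intro l
      simp only [r, r', hl, hv, Pi.add_apply, Pi.smul_apply, Fin.insertNth_apply_succAbove,
        smul_eq_mul]
      field_simp
      ring
  have h5 := frameSigma_change (h := h) (chartSection i (φ x))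
    (chartTangent i (j.insertNth (α := fun _ => ℂ) 1 r))
    (chartTangent i (j.insertNth (α := fun _ => ℂ) 0 r')) one_ne_zero hj 0 (deriv X x j) 0
  rw [one_smul, zero_smul, add_zero, add_zero, ← map_smul, ← map_smul, ← map_smul, ← map_add,
    ← h3, ← h4] at h5
  rw [h1, h5]
  rfl

end SecondLift

/-! ### The Laplacian of the logarithm of a real function. -/

section Laplacian

open InnerProductSpace Laplacian

theorem laplacian_eq_dW_dWbar {v : ℂ → ℝ} {x : ℂ} (hv : ContDiffAt ℝ 2 v x) :
    Laplacian.laplacian v x = 4 * (dW (fun z => dWbar (fun z => (v z : ℂ)) z 1) x 1).re := by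
  have h1 : ∀ᶠ z in 𝓝 x, dWbar (fun z => (v z : ℂ)) z 1 =
      ((fderiv ℝ v z 1 : ℝ) + Complex.I * (fderiv ℝ v z Complex.I : ℝ)) / 2 := by
    filter_upwards [hv.eventually (by simp)] with z hz
    have h2 : HasFDerivAt (fun z => (v z : ℂ)) (Complex.ofRealCLM.comp (fderiv ℝ v z)) z :=
      Complex.ofRealCLM.hasFDerivAt.comp z (hz.differentiableAt (by simp)).hasFDerivAt
    rw [dWbar, h2.fderiv]
    simp
  have h3 : HasFDerivAt (fderiv ℝ v) (fderiv ℝ (fderiv ℝ v) x) x :=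
    ((hv.fderiv_right (m := 1) (by norm_num)).differentiableAt (by simp)).hasFDerivAt
  have h4 : ∀ ξ : ℂ, HasFDerivAt (fun z => ((fderiv ℝ v z ξ : ℝ) : ℂ))
      (Complex.ofRealCLM.comp ((ContinuousLinearMap.apply ℝ ℝ ξ).comp
        (fderiv ℝ (fderiv ℝ v) x))) x := fun ξ =>
    Complex.ofRealCLM.hasFDerivAt.comp x
      ((ContinuousLinearMap.apply ℝ ℝ ξ).hasFDerivAt.comp x h3)
  have h5 := (((h4 1).add ((h4 Complex.I).const_mul Complex.I)).mul_const
    (2⁻¹ : ℂ)).congr_of_eventuallyEq (h1.mono fun z hz => by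
      simpa only [div_eq_mul_inv, Pi.add_apply] using hz)
  rw [dW, h5.fderiv, laplacian_eq_iteratedFDeriv_complexPlane]
  simp only [iteratedFDeriv_two_apply]
  simp
  ring

/-- This is Δ = 4∂∂̄ applied to log|q|; `β` is a formula for ∂̄q near `x`, so that `c` encodes ∂∂̄q.
-/
theorem laplacian_log_re {q : ℂ → ℂ} {x : ℂ} {a b : ℂ → ℂ → ℂ} {c d : ℂ → ℂ} {β : ℂ → ℂ}
    (hq : ContDiffAt ℝ 2 q x) (h0 : q x ≠ 0) (hreal : ∀ z, (q z).im = 0)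
    (h1 : ∀ᶠ z in 𝓝 x, HasWirtingerAt q (a z) (b z) z) (h2 : ∀ᶠ z in 𝓝 x, b z 1 = β z)
    (h3 : HasWirtingerAt β c d x) :
    ContDiffAt ℝ 2 (fun z => Real.log (q z).re) x ∧
      Laplacian.laplacian (fun z => Real.log (q z).re) x =
        4 * ((c 1 * q x - β x * a x 1) / q x ^ 2).re := by
  have hre : (q x).re ≠ 0 := fun h => h0 (Complex.ext h (hreal x))
  have hv : ContDiffAt ℝ 2 (fun z => Real.log (q z).re) x :=
    (Complex.reCLM.contDiff.contDiffAt.comp x hq).log hre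
  refine ⟨hv, ?_⟩
  have h4 : ∀ᶠ z in 𝓝 x, dWbar (fun z => (Real.log (q z).re : ℂ)) z 1 = β z / q z := by
    filter_upwards [h1, h2, hq.continuousAt.eventually_ne h0] with z h1 h2 h0
    rw [(h1.log_re h0 (.of_forall hreal)).dWbar_eq, h2]
  rw [laplacian_eq_dW_dWbar hv, ((h3.div h1.self_of_nhds h0).congr h4).dW_eq]

end Laplacian

/-! ### Local potentials of f^*ω + σ_f. -/

section LocalPotential

variable {p : ℕ} {h : Sesq p} {f : ℂ → Projectivization ℂ (V p)} {x : ℂ}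

theorem gram2_smul_smul (s u : V p) (c : ℂ) :
    gram2 h s (c • u) (c • u) = ((‖c‖ ^ 2 : ℝ) : ℂ) * gram2 h s u u := by
  rw [← Complex.normSq_eq_norm_sq, ← Complex.mul_conj]
  simp only [map_smul, LinearMap.smul_apply, map_smulₛₗ, smul_eq_mul]
  ring

theorem contDiffAt_sesq {F G : ℂ → V p} (hF : AnalyticAt ℂ F x) (hG : AnalyticAt ℂ G x) :
    ContDiffAt ℝ 2 (fun z => h (F z) (G z)) x := by
  have hF' : ContDiffAt ℝ 2 F x := hF.contDiffAt.restrict_scalars ℝ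
  have hG' : ContDiffAt ℝ 2 G x := hG.contDiffAt.restrict_scalars ℝ
  exact ((realBilin h).contDiff.contDiffAt.comp x hF').clm_apply hG'

theorem contDiffAt_gram2 {F G K : ℂ → V p} (hF : AnalyticAt ℂ F x) (hG : AnalyticAt ℂ G x)
    (hK : AnalyticAt ℂ K x) : ContDiffAt ℝ 2 (fun z => gram2 h (F z) (G z) (K z)) x :=
  ((contDiffAt_sesq hF hF).mul (contDiffAt_sesq hG hK)).sub
    ((contDiffAt_sesq hG hF).mul (contDiffAt_sesq hF hK))

theorem hasWirtingerAt_sesq_curve (h : Sesq p) {F G : ℂ → V p} {F' G' : V p}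
    (hF : HasDerivAt F F' x) (hG : HasDerivAt G G' x) :
    HasWirtingerAt (fun z => h (F z) (G z)) (fun ξ => ξ * h F' (G x)) (fun ξ => star ξ * h (F x) G')
      x :=
  (hasWirtingerAt_sesq h hF.hasFDerivAt hG.hasFDerivAt).congr_deriv (by simp) (by simp)

/-- The bracketed terms come from differentiating the base slot: they are the pairings ⟨F'∧X, F∧U⟩
and ⟨F∧X, F'∧U⟩. The first vanishes when F' is parallel to X, the second when F' is parallel to U.
-/
theorem hasWirtingerAt_gram2 (h : Sesq p) {F X U : ℂ → V p} {F' X' U' : V p}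
    (hF : HasDerivAt F F' x) (hX : HasDerivAt X X' x) (hU : HasDerivAt U U' x) :
    HasWirtingerAt (fun z => gram2 h (F z) (X z) (U z))
      (fun ξ => ξ * (gram2 h (F x) X' (U x) +
        (h F' (F x) * h (X x) (U x) - h (X x) (F x) * h F' (U x))))
      (fun ξ => star ξ * (gram2 h (F x) (X x) U' +
        (h (F x) F' * h (X x) (U x) - h (X x) F' * h (F x) (U x)))) x := by
  refine (((hasWirtingerAt_sesq_curve h hF hF).mul (hasWirtingerAt_sesq_curve h hX hU)).sub
    ((hasWirtingerAt_sesq_curve h hX hF).mul (hasWirtingerAt_sesq_curve h hF hU))).congr_deriv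
    (fun ξ => ?_) fun ξ => ?_
  all_goals rw [gram2_apply]; ring

/-- Near each point, `f^*ω = |z - x|^(2m) e^v` with `v` smooth and
`∂∂̄v = f^*ω + σ_f`, in terms of densities. -/
theorem exists_local_potential (hh : HasSignature h) (hf : ∀ x, HolomorphicNear f x)
    (hΩ : ∀ x, f x ∈ Omega h) (hpos : ∀ x, PositiveAt h f x) (x : ℂ) :
    ContinuousAt (sigmaDensity h f) x ∧ ∃ (m : ℕ) (v : ℂ → ℝ), ContDiffAt ℝ 2 v x ∧
      (∀ᶠ z in 𝓝 x, pullbackDensity h f z = ‖z - x‖ ^ (2 * m) * Real.exp (v z)) ∧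
      ∀ᶠ z in 𝓝 x, Laplacian.laplacian v z =
        4 * (pullbackDensity h f z + sigmaDensity h f z) := by
  have hi := inChart_chartAt (f x)
  have h0 : tangentGen (inCoord (chartAt (f x)) f) x x ≠ 0 := by
    intro h0
    have := hpos x
    simp [PositiveAt, h0, herm] at this
  obtain ⟨m, hfr⟩ := (hf x).isFrame_inCoord hi h0
  have hg := (hfr.positiveAt_iff hh (hΩ x) (chartTangent_ne_smul h0)).mp (hpos x)
  have hsx := hfr.sigmaDensity_eq hh (hΩ x) (chartTangent_ne_smul h0) (hpos x)
  set F : ℂ → V p := fun z => chartSection (chartAt (f x)) (inCoord (chartAt (f x)) f z)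
  set Y : ℂ → V p := fun z => chartTangent (chartAt (f x)) (tangentGen (inCoord (chartAt (f x)) f) x z)
  have hF := hfr.analytic_lift
  have hY := hfr.analytic_gen
  have hgc : ∀ᶠ z in 𝓝 x, (gram2 h (F z) (Y z) (Y z)).re < 0 :=
    (Complex.continuous_re.continuousAt.comp
      (contDiffAt_gram2 hF hY hY).continuousAt).eventually_lt_const hg
  have hNc : ∀ᶠ z in 𝓝 x, 0 < (h (F z) (F z)).re := by
    filter_upwards [hfr.lift] with z hz
    obtain ⟨hz, hfz⟩ := hz
    exact mk_mem_Omega (hfz ▸ hΩ z)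
  -- To use the frame at nearby points, the factor (z-x)^m is moved into the generator. `frameSigma`
  -- does not see it for z ≠ x; z = x is covered by the original frame.
  have hmove : ∀ᶠ z in 𝓝 x, IsFrame f F (fun z => (z - x) ^ m • Y z) 0 z := by
    filter_upwards [hF.eventually_analyticAt, hY.eventually_analyticAt, hfr.lift.eventually_nhds,
      hfr.deriv_lift.eventually_nhds] with z h1 h2 h3 h4
    exact ⟨h1, by fun_prop, h3, h4.mono fun z hz => by rw [hz, pow_zero, one_smul]⟩
  have hD : ∀ᶠ z in 𝓝 x, pullbackDensity h f z = ‖z - x‖ ^ (2 * m) *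
      (-2 * (gram2 h (F z) (Y z) (Y z)).re / (h (F z) (F z)).re ^ 2) := by
    filter_upwards [hmove] with z hz
    rw [hz.pullbackDensity_eq hh (hΩ z)]
    rw [gram2_smul_smul, Complex.re_ofReal_mul, norm_pow]
    ring
  have hσ : ∀ᶠ z in 𝓝 x, sigmaDensity h f z =
      (frameSigma h (F z) (Y z) (deriv Y z)).re := by
    filter_upwards [hmove, hgc, hY.eventually_analyticAt] with z hz hgz hYz
    rcases eq_or_ne z x with rfl | hzx
    · exact hsx
    have hδ : (z - x) ^ m ≠ 0 := pow_ne_zero m (sub_ne_zero.mpr hzx)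
    have hind : ∀ c : ℂ, (z - x) ^ m • Y z ≠ c • F z := by
      intro c hc
      have h1 : Y z = (((z - x) ^ m)⁻¹ * c) • F z := by
        rw [mul_smul, ← hc, inv_smul_smul₀ hδ]
      rw [h1] at hgz
      simp at hgz
    rw [hz.sigmaDensity_eq hh (hΩ z) hind (hpos z)]
    have h1 : HasDerivAt (fun z => (z - x) ^ m • Y z)
        ((z - x) ^ m • deriv Y z + (deriv (fun z => (z - x) ^ m) z) • Y z) z :=
      HasDerivAt.smul (c := fun z => (z - x) ^ m)
        (DifferentiableAt.hasDerivAt (by fun_prop)) hYz.differentiableAt.hasDerivAt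
    have h2 := frameSigma_change (h := h) (F z) (Y z) (deriv Y z) one_ne_zero hδ 0
      (deriv (fun z => (z - x) ^ m) z) 0
    rw [one_smul, zero_smul, add_zero, add_zero] at h2
    rw [h1.deriv, h2]
  have hlap : ∀ᶠ z in 𝓝 x,
      (ContDiffAt ℝ 2 (fun z => Real.log (h (F z) (F z)).re) z ∧
        Laplacian.laplacian (fun z => Real.log (h (F z) (F z)).re) z =
          -2 * pullbackDensity h f z) ∧
      (ContDiffAt ℝ 2 (fun z => Real.log (gram2 h (F z) (Y z) (Y z)).re) z ∧
        Laplacian.laplacian (fun z => Real.log (gram2 h (F z) (Y z) (Y z)).re) z =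
          4 * sigmaDensity h f z) := by
    filter_upwards [hσ, hD, hgc, hNc, hF.eventually_analyticAt.eventually_nhds,
      hY.eventually_analyticAt.eventually_nhds, hfr.deriv_lift.eventually_nhds]
      with z hσ hD hgz hNz hFz hYz hd
    have hFd : ∀ᶠ z in 𝓝 z, HasDerivAt F ((z - x) ^ m • Y z) z := by
      filter_upwards [hFz, hd] with z h1 h2
      exact h2 ▸ h1.differentiableAt.hasDerivAt
    have hYd : ∀ᶠ z in 𝓝 z, HasDerivAt Y (deriv Y z) z :=
      hYz.mono fun z hz => hz.differentiableAt.hasDerivAt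
    have hYd' := hYz.self_of_nhds.deriv.differentiableAt.hasDerivAt
    constructor
    -- ∂∂̄ log h(F,F) = |F∧F'|²/h(F,F)² = -D/2.
    · obtain ⟨h1, h2⟩ := laplacian_log_re (contDiffAt_sesq hFz.self_of_nhds hFz.self_of_nhds)
        (ne_zero_of_re_pos hNz) (fun z => hh.im_self _)
        (hFd.mono fun z hz => hasWirtingerAt_sesq_curve h hz hz)
        (β := fun z => h (F z) (deriv F z))
        (by filter_upwards [hd] with z hz; rw [hz]; simp)
        (hasWirtingerAt_sesq_curve h hFd.self_of_nhds
          hFz.self_of_nhds.deriv.differentiableAt.hasDerivAt)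
      refine ⟨h1, h2.trans ?_⟩
      rw [hD, hd.self_of_nhds]
      have h3 : (1 * h ((z - x) ^ m • Y z) ((z - x) ^ m • Y z) * h (F z) (F z) -
          h (F z) ((z - x) ^ m • Y z) * (1 * h ((z - x) ^ m • Y z) (F z))) / h (F z) (F z) ^ 2 =
          ((‖(z - x) ^ m‖ ^ 2 * (-1 / 2) : ℝ) : ℂ) *
            (-2 * (gram2 h (F z) (Y z) (Y z) / h (F z) (F z) ^ 2)) := by
        have h4 := gram2_smul_smul (h := h) (F z) (Y z) ((z - x) ^ m)
        rw [gram2_apply] at h4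
        push_cast at h4 ⊢
        linear_combination h4 / h (F z) (F z) ^ 2
      rw [h3, Complex.re_ofReal_mul, hh.re_norm_tangent, norm_pow]
      ring
    -- ∂∂̄ log|F∧Y|² is the Gram quotient of F∧Y and F∧Y', since F'∧Y = 0.
    · have hgz' : gram2 h (F z) (Y z) (Y z) ≠ 0 := fun h0 => by simp [h0] at hgz
      obtain ⟨h1, h2⟩ := laplacian_log_re
        (contDiffAt_gram2 hFz.self_of_nhds hYz.self_of_nhds hYz.self_of_nhds)
        hgz' (fun z => gram2_im_self hh _ _)
        ((hFd.and hYd).mono fun z hz => hasWirtingerAt_gram2 h hz.1 hz.2 hz.2)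
        (β := fun z => gram2 h (F z) (Y z) (deriv Y z))
        (.of_forall fun z => by
          simp only [map_smulₛₗ, smul_eq_mul, star_one, one_mul]; ring)
        (hasWirtingerAt_gram2 h hFd.self_of_nhds hYd.self_of_nhds hYd')
      refine ⟨h1, h2.trans ?_⟩
      rw [hσ, frameSigma]
      simp only [map_smul, LinearMap.smul_apply, smul_eq_mul]
      congr 3
      ring
  have hYd := hY.deriv
  have hfσ : ContinuousAt (fun z => (frameSigma h (F z) (Y z) (deriv Y z)).re) x := by
    have hgx : gram2 h (F x) (Y x) (Y x) ≠ 0 := fun h0 => by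
      simpa [h0] using hgc.self_of_nhds
    refine Complex.continuous_re.continuousAt.comp (ContinuousAt.div ?_ ?_ (pow_ne_zero 2 hgx))
    · exact ((contDiffAt_gram2 hF hYd hYd).continuousAt.mul
        (contDiffAt_gram2 hF hY hY).continuousAt).sub
        ((contDiffAt_gram2 hF hYd hY).continuousAt.mul (contDiffAt_gram2 hF hY hYd).continuousAt)
    · exact (contDiffAt_gram2 hF hY hY).continuousAt.pow 2
  -- The Gram determinant is negative here, so its `Real.log` is log(-|F∧Y|²), as the factor -2 in ω
  -- requires.
  refine ⟨hfσ.congr (hσ.mono fun z hz => hz.symm), m, fun z => Real.log 2 +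
    Real.log (gram2 h (F z) (Y z) (Y z)).re - 2 * Real.log (h (F z) (F z)).re, ?_, ?_, ?_⟩
  · exact (contDiffAt_const.add hlap.self_of_nhds.2.1).sub
      (contDiffAt_const.mul hlap.self_of_nhds.1.1)
  · filter_upwards [hD, hgc, hNc] with z hD hgz hNz
    rw [hD, Real.exp_sub, Real.exp_add, Real.exp_log two_pos, Real.exp_log_of_neg hgz,
      two_mul (Real.log _), Real.exp_add, Real.exp_log hNz]
    ring
  · filter_upwards [hlap] with z hz
    obtain ⟨⟨h1, h2⟩, h3, h4⟩ := hz
    have h5 := (contDiffAt_const (c := Real.log 2)).laplacian_add h3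
    have h6 := ((contDiffAt_const (c := Real.log 2)).add h3).laplacian_sub
      (contDiffAt_const.smul h1 (f := fun _ => (2 : ℝ)))
    refine h6.trans ?_
    have h7 := InnerProductSpace.laplacian_smul (2 : ℝ) h1
    erw [h5, h7, h2, h4]
    simp
    ring

end LocalPotential

/-! ### Polar coordinates and differentiation under the integral sign. -/

open Real in
theorem setIntegral_ball_eq {ρ : ℂ → ℝ} (hρ : Continuous ρ) {t : ℝ} (ht : 0 ≤ t) :
    ∫ z in Metric.ball (0 : ℂ) t, ρ z = ∫ s in (0 : ℝ)..t, 2 * π * (s * circleAverage ρ 0 s) := by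
  have hcont : Continuous fun q : ℝ × ℝ => q.1 * ρ (circleMap 0 q.1 q.2) := by fun_prop
  have h1 : ∀ q ∈ polarCoord.target,
      q.1 • (Metric.ball (0 : ℂ) t).indicator ρ (Complex.polarCoord.symm q) =
      (Set.Ioo 0 t ×ˢ Set.Ioo (-π) π).indicator (fun q => q.1 * ρ (circleMap 0 q.1 q.2)) q := by
    intro q hq
    have hq' : 0 < q.1 ∧ q.2 ∈ Set.Ioo (-π) π := by simpa [polarCoord_target] using hq
    have h2 : Complex.polarCoord.symm q = circleMap 0 q.1 q.2 := by
      rw [Complex.polarCoord_symm_apply, circleMap_zero, Complex.exp_mul_I]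
      simp
    have h3 : Complex.polarCoord.symm q ∈ Metric.ball (0 : ℂ) t ↔
        q ∈ Set.Ioo 0 t ×ˢ Set.Ioo (-π) π := by
      rw [mem_ball_zero_iff, h2, norm_circleMap_zero, abs_of_pos hq'.1, Set.mem_prod]
      exact ⟨fun h => ⟨⟨hq'.1, h⟩, hq'.2⟩, fun h => h.1.2⟩
    by_cases h4 : q ∈ Set.Ioo 0 t ×ˢ Set.Ioo (-π) π
    · rw [Set.indicator_of_mem h4, Set.indicator_of_mem (h3.mpr h4), h2, smul_eq_mul]
    · rw [Set.indicator_of_notMem h4, Set.indicator_of_notMem (mt h3.mp h4), smul_zero]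
  have hint : IntegrableOn (fun q : ℝ × ℝ => q.1 * ρ (circleMap 0 q.1 q.2))
      (Set.Ioo 0 t ×ˢ Set.Ioo (-π) π) (volume.prod volume) :=
    (hcont.continuousOn.integrableOn_compact
      (isCompact_Icc.prod isCompact_Icc)).mono_set
        (Set.prod_mono Set.Ioo_subset_Icc_self Set.Ioo_subset_Icc_self)
  have h5 : (Set.Ioo 0 t ×ˢ Set.Ioo (-π) π) ⊆ polarCoord.target := fun q hq =>
    ⟨hq.1.1, hq.2⟩
  rw [← integral_indicator Metric.isOpen_ball.measurableSet,
    ← Complex.integral_comp_polarCoord_symm,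
    setIntegral_congr_fun polarCoord.open_target.measurableSet h1,
    setIntegral_indicator (measurableSet_Ioo.prod measurableSet_Ioo),
    Set.inter_eq_self_of_subset_right h5, Measure.volume_eq_prod, setIntegral_prod _ hint,
    intervalIntegral.integral_of_le ht, integral_Ioc_eq_integral_Ioo]
  refine integral_congr_ae (.of_forall fun s => ?_)
  have hper : Function.Periodic (fun θ => ρ (circleMap 0 s θ)) (2 * π) := fun θ => by
    simp [periodic_circleMap 0 s θ]
  have h6 : ∫ θ in Set.Ioo (-π) π, s * ρ (circleMap 0 s θ) =
      s * ∫ θ in (0 : ℝ)..2 * π, ρ (circleMap 0 s θ) := by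
    rw [← integral_Ioc_eq_integral_Ioo, ← intervalIntegral.integral_of_le (by linarith [pi_pos]),
      intervalIntegral.integral_const_mul]
    have := hper.intervalIntegral_add_eq (-π) 0
    rw [show -π + 2 * π = π by ring, zero_add] at this
    rw [this]
  simp only [h6, circleAverage_def, smul_eq_mul]
  field_simp

theorem hasDerivAt_integral_of_continuous {F F' : ℝ → ℝ → ℝ}
    (hF : Continuous fun q : ℝ × ℝ => F q.1 q.2)
    (hF' : Continuous fun q : ℝ × ℝ => F' q.1 q.2)
    (hd : ∀ t θ, HasDerivAt (fun t => F t θ) (F' t θ) t)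
    (a b t : ℝ) : HasDerivAt (fun t => ∫ θ in a..b, F t θ) (∫ θ in a..b, F' t θ) t := by
  obtain ⟨C, hC⟩ := ((isCompact_Icc (a := t - 1) (b := t + 1)).prod
    (isCompact_uIcc (a := a) (b := b))).exists_bound_of_continuousOn hF'.continuousOn
  refine (intervalIntegral.hasDerivAt_integral_of_dominated_loc_of_deriv_le
    (bound := fun _ => C) (Icc_mem_nhds (by linarith : t - 1 < t) (by linarith : t < t + 1))
    (.of_forall fun s => ?_) ?_ ?_ (.of_forall fun θ hθ s hs => ?_) (by simp)
    (.of_forall fun θ _ s _ => hd s θ)).2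
  · exact (Continuous.aestronglyMeasurable (by fun_prop))
  · exact Continuous.intervalIntegrable (by fun_prop) _ _
  · exact (Continuous.aestronglyMeasurable (by fun_prop))
  · exact hC (s, θ) ⟨hs, Set.uIoc_subset_uIcc hθ⟩

/-! ### Jensen's formula for functions of class C². -/

section Jensen

open Real InnerProductSpace

/-- The trace of the Hessian is the same in every orthonormal basis; (e, ie) is the radial and
angular one on a circle. -/
theorem laplacian_eq_of_rotation {v : ℂ → ℝ} (z e : ℂ) (he : ‖e‖ = 1) :
    Laplacian.laplacian v z = fderiv ℝ (fderiv ℝ v) z e e +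
      fderiv ℝ (fderiv ℝ v) z (Complex.I * e) (Complex.I * e) := by
  rw [laplacian_eq_iteratedFDeriv_complexPlane]
  simp only [iteratedFDeriv_two_apply]
  have h1 : e = e.re • (1 : ℂ) + e.im • Complex.I := by
    simp [Complex.re_add_im]
  have h2 : Complex.I * e = (-e.im) • (1 : ℂ) + e.re • Complex.I := by
    apply Complex.ext <;> simp
  have h3 : e.re ^ 2 + e.im ^ 2 = 1 := by
    have := Complex.normSq_eq_norm_sq e
    rw [he, Complex.normSq_apply] at this
    linarith
  rw [h2]
  conv_rhs => rw [h1]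
  simp only [map_add, map_smul, add_apply, smul_apply, smul_eq_mul]
  simp
  linear_combination (-(fderiv ℝ (fderiv ℝ v) z 1 1) -
    fderiv ℝ (fderiv ℝ v) z Complex.I Complex.I) * h3

/-- By the divergence theorem the integral of Δv over the disc is t times the angular integral of
the radial derivative; dividing by t and integrating recovers the circle average. -/
theorem circleAverage_sub_eq_integral_laplacian {v : ℂ → ℝ} (hv : ContDiff ℝ 2 v) {r : ℝ}
    (hr : 1 ≤ r) : 2 * π * (circleAverage v 0 r - circleAverage v 0 1) =
      ∫ t in (1 : ℝ)..r, (∫ z in Metric.ball (0 : ℂ) t, Laplacian.laplacian v z) / t := by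
  have hv1 : ContDiff ℝ 1 (fderiv ℝ v) := hv.fderiv_right (by norm_num)
  have hc1 : Continuous (fderiv ℝ v) := hv1.continuous
  have hc2 : Continuous (fderiv ℝ (fderiv ℝ v)) := hv1.continuous_fderiv (by simp)
  have hlap : Continuous (Laplacian.laplacian v) := by
    have : Laplacian.laplacian v = fun z => fderiv ℝ (fderiv ℝ v) z 1 1 +
        fderiv ℝ (fderiv ℝ v) z (Complex.I * 1) (Complex.I * 1) :=
      funext fun z => laplacian_eq_of_rotation z 1 (by simp)
    rw [this]
    fun_prop
  have hd1 : ∀ z, HasFDerivAt v (fderiv ℝ v z) z := fun z =>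
    (hv.differentiable (by simp) z).hasFDerivAt
  have hd2 : ∀ z, HasFDerivAt (fderiv ℝ v) (fderiv ℝ (fderiv ℝ v) z) z := fun z =>
    (hv1.differentiable (by simp) z).hasFDerivAt
  set e : ℝ → ℂ := circleMap 0 1 with he
  have hec : Continuous e := continuous_circleMap 0 1
  have hnorm : ∀ θ, ‖e θ‖ = 1 := fun θ => by simp [he]
  have hmap : ∀ t θ, circleMap 0 t θ = t * e θ := fun t θ => by simp [he, circleMap_zero]
  have hcm : Continuous fun q : ℝ × ℝ => circleMap 0 q.1 q.2 := by fun_prop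
  have hrad : ∀ t θ, HasDerivAt (fun t => circleMap 0 t θ) (e θ) t := fun t θ => by
    simp only [hmap]
    simpa using (Complex.ofRealCLM.hasDerivAt (x := t)).mul_const (e θ)
  have hang : ∀ t θ, HasDerivAt (circleMap 0 t) (t * (Complex.I * e θ)) θ := fun t θ => by
    refine (hasDerivAt_circleMap 0 t θ).congr_deriv ?_
    rw [hmap]
    ring
  have hange : ∀ θ, HasDerivAt e (Complex.I * e θ) θ := fun θ => by
    simpa using hang 1 θ
  have h1 : ∀ t, HasDerivAt (fun t => ∫ θ in (0 : ℝ)..2 * π, v (circleMap 0 t θ))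
      (∫ θ in (0 : ℝ)..2 * π, fderiv ℝ v (circleMap 0 t θ) (e θ)) t := fun t =>
    hasDerivAt_integral_of_continuous (hv.continuous.comp hcm) (by fun_prop)
      (fun t θ => (hd1 _).comp_hasDerivAt t (hrad t θ)) _ _ t
  have h2 : ∀ t, HasDerivAt (fun t => ∫ θ in (0 : ℝ)..2 * π, fderiv ℝ v (circleMap 0 t θ) (e θ))
      (∫ θ in (0 : ℝ)..2 * π, fderiv ℝ (fderiv ℝ v) (circleMap 0 t θ) (e θ) (e θ)) t := fun t =>
    hasDerivAt_integral_of_continuous (F := fun t θ => fderiv ℝ v (circleMap 0 t θ) (e θ))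
      (F' := fun t θ => fderiv ℝ (fderiv ℝ v) (circleMap 0 t θ) (e θ) (e θ))
      (by fun_prop) (by fun_prop) (fun t θ => (((hd2 _).comp_hasDerivAt t (hrad t θ)).clm_apply
        (hasDerivAt_const t (e θ))).congr_deriv (by simp)) _ _ t
  -- The integrand is the θ-derivative of the 2π-periodic function dv(i e(θ)).
  have h3 : ∀ t : ℝ, ∫ θ in (0 : ℝ)..2 * π,
      (t * fderiv ℝ (fderiv ℝ v) (circleMap 0 t θ) (Complex.I * e θ) (Complex.I * e θ) -
        fderiv ℝ v (circleMap 0 t θ) (e θ)) = 0 := by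
    intro t
    rw [intervalIntegral.integral_eq_sub_of_hasDerivAt
      (f := fun θ => fderiv ℝ v (circleMap 0 t θ) (Complex.I * e θ))]
    · have h4 : circleMap 0 t (2 * π) = circleMap 0 t 0 := by
        simpa using periodic_circleMap 0 t 0
      have h5 : e (2 * π) = e 0 := by simpa using periodic_circleMap 0 1 0
      rw [h4, h5, sub_self]
    · intro θ _
      refine (((hd2 _).comp_hasDerivAt θ (hang t θ)).clm_apply
        ((hange θ).const_mul Complex.I)).congr_deriv ?_
      have h4 : Complex.I * (Complex.I * e θ) = -e θ := by
        rw [← mul_assoc, Complex.I_mul_I, neg_one_mul]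
      have h5 : (t : ℂ) * (Complex.I * e θ) = t • (Complex.I * e θ) := by simp
      simp only [h4, h5, map_smul, smul_apply, map_neg, smul_eq_mul, Function.comp]
      ring
    · exact Continuous.intervalIntegrable (by fun_prop) _ _
  have h4 : ∀ t : ℝ, HasDerivAt
      (fun t : ℝ => t * ∫ θ in (0 : ℝ)..2 * π, fderiv ℝ v (circleMap 0 t θ) (e θ))
      (2 * π * (t * circleAverage (Laplacian.laplacian v) 0 t)) t := by
    intro t
    refine ((hasDerivAt_id t).mul (h2 t)).congr_deriv ?_
    have h5 : ∫ θ in (0 : ℝ)..2 * π, Laplacian.laplacian v (circleMap 0 t θ) =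
        (∫ θ in (0 : ℝ)..2 * π, fderiv ℝ (fderiv ℝ v) (circleMap 0 t θ) (e θ) (e θ)) +
        ∫ θ in (0 : ℝ)..2 * π,
          fderiv ℝ (fderiv ℝ v) (circleMap 0 t θ) (Complex.I * e θ) (Complex.I * e θ) := by
      rw [← intervalIntegral.integral_add]
      · exact intervalIntegral.integral_congr fun θ _ =>
          laplacian_eq_of_rotation _ _ (hnorm θ)
      all_goals exact Continuous.intervalIntegrable (by fun_prop) _ _
    have h6 := h3 t
    rw [intervalIntegral.integral_sub, intervalIntegral.integral_const_mul] at h6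
    · rw [circleAverage_def, h5, smul_eq_mul]
      field_simp
      simp
      linarith
    all_goals exact Continuous.intervalIntegrable (by fun_prop) _ _
  have h5 : ∀ t : ℝ, 0 ≤ t → ∫ z in Metric.ball (0 : ℂ) t, Laplacian.laplacian v z =
      t * ∫ θ in (0 : ℝ)..2 * π, fderiv ℝ v (circleMap 0 t θ) (e θ) := by
    intro t ht
    rw [setIntegral_ball_eq hlap ht, intervalIntegral.integral_eq_sub_of_hasDerivAt
      (fun s _ => h4 s) (Continuous.intervalIntegrable (by fun_prop) _ _)]
    simp
  have h6 : ∫ t in (1 : ℝ)..r, (∫ z in Metric.ball (0 : ℂ) t, Laplacian.laplacian v z) / t =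
      ∫ t in (1 : ℝ)..r, ∫ θ in (0 : ℝ)..2 * π, fderiv ℝ v (circleMap 0 t θ) (e θ) := by
    refine intervalIntegral.integral_congr fun t ht => ?_
    rw [Set.uIcc_of_le hr] at ht
    have ht0 : 0 < t := by linarith [ht.1]
    simp only [h5 t ht0.le]
    field_simp
  rw [h6, intervalIntegral.integral_eq_sub_of_hasDerivAt (fun t _ => h1 t)
    ((continuous_iff_continuousAt.mpr fun t => (h2 t).continuousAt).intervalIntegrable _ _)]
  simp only [circleAverage_def, smul_eq_mul]
  field_simp

/-- Jensen's formula for a function of class `C^2` on a disc. -/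
theorem circleAverage_sub_eq_integral_laplacian_of_ball {v : ℂ → ℝ} {r R : ℝ} (hr : 1 ≤ r)
    (hrR : r < R) (hv : ∀ z, ‖z‖ < R → ContDiffAt ℝ 2 v z) :
    2 * π * (circleAverage v 0 r - circleAverage v 0 1) =
      ∫ t in (1 : ℝ)..r, (∫ z in Metric.ball (0 : ℂ) t, Laplacian.laplacian v z) / t := by
  -- The cutoff is 1 on the disc of radius r and dies before R, which makes `v` globally C² without
  -- changing either side.
  let χ : ContDiffBump (0 : ℂ) := ⟨r, (r + R) / 2, by linarith, by linarith⟩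
  have hχ : ContDiff ℝ 2 fun z => χ z * v z := by
    rw [contDiff_iff_contDiffAt]
    intro z
    by_cases hz : ‖z‖ < R
    · exact χ.contDiff.contDiffAt.mul (hv z hz)
    · have h1 : ∀ᶠ w in 𝓝 z, (r + R) / 2 < ‖w‖ :=
        continuous_norm.continuousAt.eventually_const_lt (by linarith)
      refine (contDiffAt_const (c := (0 : ℝ))).congr_of_eventuallyEq ?_
      filter_upwards [h1] with w hw
      rw [χ.zero_of_le_dist (by simpa using hw.le), zero_mul]
  have heq : ∀ z, ‖z‖ ≤ r → χ z * v z = v z := fun z hz => by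
    rw [χ.one_of_mem_closedBall (by simpa using hz), one_mul]
  have hav : ∀ t, 0 ≤ t → t ≤ r →
      circleAverage (fun z => χ z * v z) 0 t = circleAverage v 0 t := fun t ht htr =>
    circleAverage_congr_sphere fun z hz => heq z (by
      rw [mem_sphere_zero_iff_norm, abs_of_nonneg ht] at hz
      linarith)
  rw [← hav r (by linarith) le_rfl, ← hav 1 zero_le_one hr,
    circleAverage_sub_eq_integral_laplacian hχ hr]
  refine intervalIntegral.integral_congr fun t ht => ?_
  rw [Set.uIcc_of_le hr] at ht
  refine congrArg (· / t) ?_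
  refine setIntegral_congr_fun Metric.isOpen_ball.measurableSet fun z hz => ?_
  refine (laplacian_congr_nhds ?_).self_of_nhds
  filter_upwards [Metric.isOpen_ball.mem_nhds hz] with w hw
  exact heq w (by rw [mem_ball_zero_iff] at hw; linarith [ht.2])

end Jensen

/-! ### Nevanlinna estimates for a singular density. -/

section Nevanlinna

open Real InnerProductSpace

/-- The density `D` of a singular metric on `ℂ`: locally `D = |z - x|^(2m) e^v` with `v` of class
`C^2`, and `∂∂̄v = τ`. -/
def HasPotentials (D τ : ℂ → ℝ) : Prop :=
  ∀ x : ℂ, ∃ (m : ℕ) (v : ℂ → ℝ), ContDiffAt ℝ 2 v x ∧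
    (∀ᶠ z in 𝓝 x, D z = ‖z - x‖ ^ (2 * m) * exp (v z)) ∧
    ∀ᶠ z in 𝓝 x, Laplacian.laplacian v z = 4 * τ z

variable {D τ : ℂ → ℝ}

theorem HasPotentials.eventually_pos (h : HasPotentials D τ) (x : ℂ) :
    ∀ᶠ z in 𝓝[≠] x, 0 < D z := by
  obtain ⟨m, v, -, h2, -⟩ := h x
  filter_upwards [h2.filter_mono nhdsWithin_le_nhds, self_mem_nhdsWithin] with z hz hzx
  rw [hz]
  have : 0 < ‖z - x‖ := norm_pos_iff.mpr (sub_ne_zero.mpr hzx)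
  positivity

theorem HasPotentials.nonneg (h : HasPotentials D τ) (x : ℂ) : 0 ≤ D x := by
  obtain ⟨m, v, -, h2, -⟩ := h x
  rw [h2.self_of_nhds]
  positivity

theorem HasPotentials.continuous (h : HasPotentials D τ) : Continuous D := by
  rw [continuous_iff_continuousAt]
  intro x
  obtain ⟨m, v, h1, h2, -⟩ := h x
  have h3 : ContinuousAt (fun z => ‖z - x‖ ^ (2 * m) * exp (v z)) x :=
    ContinuousAt.mul (by fun_prop) (continuous_exp.continuousAt.comp h1.continuousAt)
  exact h3.congr (h2.mono fun z hz => hz.symm)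

theorem HasPotentials.finite_zeros (h : HasPotentials D τ) (R : ℝ) :
    {z ∈ Metric.closedBall (0 : ℂ) R | D z = 0}.Finite := by
  by_contra hinf
  obtain ⟨x, -, hx⟩ := Set.Infinite.exists_accPt_of_subset_isCompact hinf
    (isCompact_closedBall (0 : ℂ) R) (Set.sep_subset _ _)
  rw [accPt_iff_frequently_nhdsNE] at hx
  obtain ⟨z, hz, hz'⟩ := (hx.and_eventually (h.eventually_pos x)).exists
  exact hz'.ne' hz.2

theorem harmonicAt_sum_log {Z : Finset ℂ} {c : ℂ → ℝ} {x : ℂ} (hx : x ∉ Z) :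
    HarmonicAt (fun z => ∑ a ∈ Z, c a * log ‖z - a‖) x := by
  classical
  induction Z using Finset.induction_on with
  | empty => simp
  | insert a s ha ih =>
    rw [Finset.mem_insert, not_or] at hx
    simp only [Finset.sum_insert ha]
    exact ((AnalyticAt.harmonicAt_log_norm (f := fun z => z - a) (by fun_prop)
      (sub_ne_zero.mpr hx.1)).const_smul (c := c a)).add (ih hx.2)

/-- The average of log|z - a| over |z| = s is log max(s, |a|). -/
theorem circleAverage_log_norm_mono (a : ℂ) {r : ℝ} (hr : 1 ≤ r) :
    circleAverage (fun z => log ‖z - a‖) 0 1 ≤ circleAverage (fun z => log ‖z - a‖) 0 r := by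
  have hr0 : 0 < r := by linarith
  rw [circleAverage_log_norm_sub_const_eq_log_radius_add_posLog one_ne_zero,
    circleAverage_log_norm_sub_const_eq_log_radius_add_posLog hr0.ne']
  simp only [log_one, inv_one, one_mul, zero_add, zero_sub, norm_neg, posLog]
  refine max_le (add_nonneg (log_nonneg hr) (le_max_left _ _)) ?_
  rcases eq_or_ne a 0 with rfl | ha
  · simp [log_nonneg hr]
  · have ha' : 0 < ‖a‖ := norm_pos_iff.mpr ha
    have h1 : log (r⁻¹ * ‖a‖) = log ‖a‖ - log r := by
      rw [log_mul (by positivity) ha'.ne', log_inv]; ring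
    linarith [le_max_right 0 (log (r⁻¹ * ‖a‖))]

/-- Jensen's inequality `∫_1^r dt/t ∫_{|z| < t} ∂∂̄ log D ≤ (1/4) ∫ log D dθ |_1^r`: the zeros of `D`
only contribute a non-negative term. -/
theorem HasPotentials.charFun_le (h : HasPotentials D τ) {r : ℝ} (hr : 1 ≤ r) :
    CircleIntegrable (fun z => log (D z)) 0 r ∧ charFun τ r ≤
      π / 2 * (circleAverage (fun z => log (D z)) 0 r -
        circleAverage (fun z => log (D z)) 0 1) := by
  classical
  choose m v hv hD hlap using h
  have hfin := HasPotentials.finite_zeros (fun x => ⟨m x, v x, hv x, hD x, hlap x⟩) (r + 1)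
  have hzero : ∀ x, m x ≠ 0 → D x = 0 := fun x hx => by
    rw [(hD x).self_of_nhds, sub_self, norm_zero, zero_pow (by omega), zero_mul]
  have hDv : ∀ x, D x ≠ 0 → D x = exp (v x x) := fun x hx => by
    have hm : m x = 0 := by_contra fun hm => hx (hzero x hm)
    rw [(hD x).self_of_nhds, hm]
    simp
  set Z := hfin.toFinset with hZ
  have hZmem : ∀ z, z ∈ Z ↔ ‖z‖ ≤ r + 1 ∧ D z = 0 := fun z => by simp [hZ]
  set c : ℂ → ℝ := fun a => 2 * m a with hc
  -- Away from the zeros of D, `v z z` is log D(z), so `u` is log D with its logarithmic poles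
  -- removed. At a zero the convention log 0 = 0 makes `u` take the C² value.
  set u : ℂ → ℝ := fun z => v z z - ∑ a ∈ Z, c a * log ‖z - a‖ with hu
  have hloc : ∀ x, ‖x‖ < r + 1 →
      u =ᶠ[𝓝 x] v x - fun z => ∑ a ∈ Z.erase x, c a * log ‖z - a‖ := by
    intro x hx
    have hpos := eventually_nhdsWithin_iff.mp
      (HasPotentials.eventually_pos (fun x => ⟨m x, v x, hv x, hD x, hlap x⟩) x)
    filter_upwards [hD x, hpos] with z hz hpos
    have h1 : ∑ a ∈ Z, c a * log ‖z - a‖ =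
        c x * log ‖z - x‖ + ∑ a ∈ Z.erase x, c a * log ‖z - a‖ := by
      by_cases hxZ : x ∈ Z
      · exact (Finset.add_sum_erase Z _ hxZ).symm
      · have hmx : m x = 0 := by_contra fun hm => hxZ ((hZmem x).mpr ⟨hx.le, hzero x hm⟩)
        rw [Finset.erase_eq_of_notMem hxZ, hc]
        simp [hmx]
    have h2 : v z z = c x * log ‖z - x‖ + v x z := by
      rcases eq_or_ne z x with rfl | hzx
      · simp
      · have h3 := hDv z (hpos hzx).ne'
        have h4 : 0 < ‖z - x‖ := norm_pos_iff.mpr (sub_ne_zero.mpr hzx)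
        rw [hz] at h3
        have h5 := congrArg log h3
        rw [log_mul (by positivity) (exp_pos _).ne', log_exp, log_exp, log_pow] at h5
        rw [← h5, hc]
        push_cast
        ring
    simp only [hu, Pi.sub_apply, h1, h2]
    ring
  have hharm : ∀ x, HarmonicAt (fun z => ∑ a ∈ Z.erase x, c a * log ‖z - a‖) x := fun x =>
    harmonicAt_sum_log (Finset.notMem_erase x Z)
  have hsmooth : ∀ x, ‖x‖ < r + 1 → ContDiffAt ℝ 2 u x := fun x hx =>
    ((hv x).sub (hharm x).1).congr_of_eventuallyEq (hloc x hx)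
  have hlapu : ∀ x, ‖x‖ < r + 1 → Laplacian.laplacian u x = 4 * τ x := fun x hx => by
    rw [(laplacian_congr_nhds (hloc x hx)).self_of_nhds, (hv x).laplacian_sub (hharm x).1,
      (hlap x).self_of_nhds, (hharm x).2.self_of_nhds]
    simp
  have hjensen := circleAverage_sub_eq_integral_laplacian_of_ball hr (by linarith) hsmooth
  have hchar : ∫ t in (1 : ℝ)..r, (∫ z in Metric.ball (0 : ℂ) t, Laplacian.laplacian u z) / t =
      4 * charFun τ r := by
    rw [charFun, ← intervalIntegral.integral_const_mul]
    refine intervalIntegral.integral_congr fun t ht => ?_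
    rw [Set.uIcc_of_le hr] at ht
    have : ∫ z in Metric.ball (0 : ℂ) t, Laplacian.laplacian u z =
        ∫ z in Metric.ball (0 : ℂ) t, 4 * τ z :=
      setIntegral_congr_fun Metric.isOpen_ball.measurableSet fun z hz => hlapu z (by
        rw [mem_ball_zero_iff] at hz; linarith [ht.2])
    simp only [this, integral_const_mul]
    ring
  have hint : ∀ s, 0 ≤ s → s ≤ r → CircleIntegrable u 0 s := fun s hs hsr =>
    ContinuousOn.circleIntegrable hs fun z hz => (hsmooth z (by
      rw [mem_sphere_zero_iff_norm] at hz; linarith)).continuousAt.continuousWithinAt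
  have hlogint : ∀ a s, CircleIntegrable (fun z => c a * log ‖z - a‖) 0 s := fun a s =>
    (circleIntegrable_log_norm_sub_const (a := a) (c := 0) s).const_smul (a := c a)
  have hsum : ∀ s, CircleIntegrable (fun z => ∑ a ∈ Z, c a * log ‖z - a‖) 0 s := fun s =>
    CircleIntegrable.fun_sum Z fun a _ => hlogint a s
  have hae : ∀ s, 0 ≤ s → s ≤ r → (fun z => u z + ∑ a ∈ Z, c a * log ‖z - a‖)
      =ᶠ[codiscreteWithin (Metric.sphere 0 |s|)] fun z => log (D z) := by
    intro s hs hsr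
    filter_upwards [compl_finite_mem_codiscreteWithin Z.finite_toSet,
      self_mem_codiscreteWithin _] with z hz hzs
    rw [mem_sphere_zero_iff_norm, abs_of_nonneg hs] at hzs
    have hDz : D z ≠ 0 := fun h0 => hz ((hZmem z).mpr ⟨by linarith, h0⟩)
    simp only [hu, sub_add_cancel, hDv z hDz, log_exp]
  have hav : ∀ s, 0 < s → s ≤ r → circleAverage (fun z => log (D z)) 0 s =
      circleAverage u 0 s + ∑ a ∈ Z, c a * circleAverage (fun z => log ‖z - a‖) 0 s := by
    intro s hs hsr
    rw [← circleAverage_congr_codiscreteWithin (hae s hs.le hsr) hs.ne',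
      circleAverage_fun_add (hint s hs.le hsr) (hsum s),
      circleAverage_fun_sum fun a _ => hlogint a s]
    congr 1
    exact Finset.sum_congr rfl fun a _ =>
      circleAverage_fun_smul (a := c a) (f := fun z => log ‖z - a‖)
  refine ⟨((hint r (by linarith) le_rfl).add (hsum r)).congr_codiscreteWithin
    (hae r (by linarith) le_rfl), ?_⟩
  have hmono : ∑ a ∈ Z, c a * circleAverage (fun z => log ‖z - a‖) 0 1 ≤
      ∑ a ∈ Z, c a * circleAverage (fun z => log ‖z - a‖) 0 r :=
    Finset.sum_le_sum fun a _ => mul_le_mul_of_nonneg_left (circleAverage_log_norm_mono a hr)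
      (by positivity)
  rw [hav r (by linarith) le_rfl, hav 1 one_pos hr]
  rw [hchar] at hjensen
  have hπ := pi_pos
  nlinarith

/-- Concavity of the logarithm, through log t ≤ t - 1 at t = D/c. At zeros of D, where log 0 = 0, `1
≤ c` is needed. -/
theorem circleAverage_log_le {r c : ℝ} (hD : Continuous D) (hD0 : ∀ z, 0 ≤ D z)
    (hint : CircleIntegrable (fun z => log (D z)) 0 r) (hc : 1 ≤ c)
    (hle : circleAverage D 0 r ≤ c) :
    circleAverage (fun z => log (D z)) 0 r ≤ 1 + log c := by
  have hDc : CircleIntegrable (fun z => c⁻¹ * D z) 0 r :=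
    (Continuous.continuousOn (by fun_prop)).circleIntegrable'
  have h1 : circleAverage (fun z => log (D z)) 0 r ≤
      circleAverage (fun z => c⁻¹ * D z + log c) 0 r := by
    refine circleAverage_mono hint (hDc.add (circleIntegrable_const _ _ _)) fun z _ => ?_
    rcases (hD0 z).eq_or_lt with h0 | h0
    · simp [← h0, log_nonneg hc]
    · have h2 := log_le_sub_one_of_pos (show 0 < c⁻¹ * D z by positivity)
      rw [log_mul (by positivity) h0.ne', log_inv] at h2
      linarith
  rw [circleAverage_fun_add hDc (circleIntegrable_const _ _ _), circleAverage_const] at h1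
  have h3 : circleAverage (fun z => c⁻¹ * D z) 0 r = c⁻¹ * circleAverage D 0 r :=
    circleAverage_fun_smul (a := c⁻¹) (f := D)
  have h4 : c⁻¹ * circleAverage D 0 r ≤ 1 := by
    rw [inv_mul_le_iff₀ (by linarith)]
    linarith
  linarith

/-- Borel's growth lemma. -/
theorem volume_sq_lt_deriv_lt_top {y y' : ℝ → ℝ} {a : ℝ} (hy : ∀ r, a ≤ r → HasDerivAt y (y' r) r)
    (hy' : ContinuousOn y' (Set.Ici a)) (h0 : ∀ r, a ≤ r → 0 ≤ y' r) (hpos : ∀ r, a ≤ r → 0 < y r) :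
    volume {r | a < r ∧ y r ^ 2 < y' r} < ⊤ := by
  have hyc : ContinuousOn y (Set.Ici a) := fun r hr => (hy r hr).continuousAt.continuousWithinAt
  have hc : ContinuousOn (fun r => y' r / y r ^ 2) (Set.Ici a) :=
    hy'.div (hyc.pow 2) fun r hr => pow_ne_zero 2 (hpos r hr).ne'
  -- y'/y² is the derivative of -1/y, so its integral is at most 1/y(a); Markov's inequality bounds
  -- the set where it exceeds 1.
  have hint : IntegrableOn (fun r => y' r / y r ^ 2) (Set.Ioi a) := by
    refine integrableOn_Ioi_of_intervalIntegral_norm_bounded (1 / y a) a (b := id) (l := atTop)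
      (fun R => ?_) tendsto_id ?_
    · exact ((hc.mono Set.Icc_subset_Ici_self).integrableOn_compact isCompact_Icc).mono_set
        Set.Ioc_subset_Icc_self
    · filter_upwards [eventually_ge_atTop a] with R hR
      have hsub : Set.uIcc a R ⊆ Set.Ici a := by
        rw [Set.uIcc_of_le hR]; exact Set.Icc_subset_Ici_self
      have h1 : ∫ r in a..R, ‖y' r / y r ^ 2‖ = ∫ r in a..R, y' r / y r ^ 2 :=
        intervalIntegral.integral_congr fun r hr => by
          have := h0 r (hsub hr)
          exact norm_of_nonneg (by positivity)
      rw [id, h1, intervalIntegral.integral_eq_sub_of_hasDerivAt (f := fun r => -(y r)⁻¹)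
        (fun r hr => (((hy r (hsub hr)).inv (hpos r (hsub hr)).ne').neg).congr_deriv (by ring))
        ((hc.mono hsub).intervalIntegrable)]
      have := hpos R hR
      have : 0 < (y R)⁻¹ := by positivity
      rw [one_div]
      linarith
  rw [← Measure.restrict_eq_self volume
    (show {r | a < r ∧ y r ^ 2 < y' r} ⊆ Set.Ioi a from fun r hr => hr.1)]
  refine lt_of_le_of_lt (measure_mono fun r hr => ?_) (hint.measure_norm_ge_lt_top one_pos)
  have h2 : 0 < y r ^ 2 := pow_pos (hpos r hr.1.le) 2
  rw [Set.mem_ofPred_eq, norm_of_nonneg (div_nonneg (h0 r hr.1.le) h2.le), one_le_div h2]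
  exact hr.2.le

/-- The second main theorem type estimate for a density `D` whose potentials satisfy
`∂∂̄v = D + σ`. -/
theorem HasPotentials.leExcO {σ : ℂ → ℝ} (h : HasPotentials D (fun z => D z + σ z))
    (hσ : Continuous σ) : LeExcO (fun r => 1 * charFun D r + charFun σ r)
      (fun r => log r + log (charFun D r)) := by
  have hD := h.continuous
  have hD0 := h.nonneg
  have hball : ∀ {ρ : ℂ → ℝ}, Continuous ρ → ∀ t, IntegrableOn ρ (Metric.ball 0 t) :=
    fun hρ t => (hρ.continuousOn.integrableOn_compact (isCompact_closedBall (0 : ℂ) t)).mono_set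
      Metric.ball_subset_closedBall
  have hP : ∀ {ρ : ℂ → ℝ}, Continuous ρ →
      Continuous fun s => 2 * π * (s * circleAverage ρ 0 s) := fun hρ => by fun_prop
  have hA : ∀ {ρ : ℂ → ℝ}, Continuous ρ → ∀ t,
      HasDerivAt (fun t => ∫ s in (0 : ℝ)..t, 2 * π * (s * circleAverage ρ 0 s))
        (2 * π * (t * circleAverage ρ 0 t)) t := fun hρ t =>
    ((hP hρ).integral_hasStrictDerivAt 0 t).hasDerivAt
  have hAdiv : ∀ {ρ : ℂ → ℝ}, Continuous ρ → ContinuousOn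
      (fun t => (∫ s in (0 : ℝ)..t, 2 * π * (s * circleAverage ρ 0 s)) / t) (Set.Ioi 0) :=
    fun hρ t ht => ((hA hρ t).continuousAt.div continuousAt_id
      (ne_of_gt ht)).continuousWithinAt
  have hII : ∀ {ρ : ℂ → ℝ}, Continuous ρ → ∀ r, 1 ≤ r → IntervalIntegrable
      (fun t => (∫ s in (0 : ℝ)..t, 2 * π * (s * circleAverage ρ 0 s)) / t) volume 1 r :=
    fun hρ r hr => ((hAdiv hρ).mono fun t ht => by
      rw [Set.uIcc_of_le hr] at ht; exact lt_of_lt_of_le one_pos ht.1).intervalIntegrable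
  have hchar : ∀ {ρ : ℂ → ℝ}, Continuous ρ → ∀ r, 1 ≤ r → charFun ρ r =
      ∫ t in (1 : ℝ)..r, (∫ s in (0 : ℝ)..t, 2 * π * (s * circleAverage ρ 0 s)) / t :=
    fun hρ r hr => intervalIntegral.integral_congr fun t ht => by
      rw [Set.uIcc_of_le hr] at ht
      simp only [setIntegral_ball_eq hρ (zero_le_one.trans ht.1)]
  have hadd : ∀ r, 1 ≤ r → charFun (fun z => D z + σ z) r = charFun D r + charFun σ r := by
    intro r hr
    rw [hchar hD r hr, hchar hσ r hr, ← intervalIntegral.integral_add (hII hD r hr) (hII hσ r hr),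
      charFun]
    refine intervalIntegral.integral_congr fun t ht => ?_
    rw [Set.uIcc_of_le hr] at ht
    have ht0 := zero_le_one.trans ht.1
    simp only [integral_add (hball hD t) (hball hσ t), setIntegral_ball_eq hD ht0,
      setIntegral_ball_eq hσ ht0]
    ring
  set A : ℝ → ℝ := fun t => ∫ s in (0 : ℝ)..t, 2 * π * (s * circleAverage D 0 s)
  set T : ℝ → ℝ := fun r => ∫ t in (1 : ℝ)..r, A t / t
  have hAball : ∀ t, 0 ≤ t → A t = ∫ z in Metric.ball 0 t, D z := fun t ht =>
    (setIntegral_ball_eq hD ht).symm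
  have hA1 : 0 < A 1 := by
    rw [hAball 1 zero_le_one, setIntegral_pos_iff_support_of_nonneg_ae (.of_forall hD0)
      (hball hD 1)]
    refine (hD.isOpen_support.inter Metric.isOpen_ball).measure_pos volume ?_
    obtain ⟨z, hz, hz'⟩ := ((h.eventually_pos 0).and
      (nhdsWithin_le_nhds (Metric.ball_mem_nhds (0 : ℂ) one_pos))).exists
    exact ⟨z, hz.ne', hz'⟩
  have hAge : ∀ t, 1 ≤ t → A 1 ≤ A t := fun t ht => by
    rw [hAball 1 zero_le_one, hAball t (by linarith)]
    exact setIntegral_mono_set (hball hD t) (.of_forall hD0)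
      (Metric.ball_subset_ball ht).eventuallyLE
  have hT : ∀ r, 0 < r → HasDerivAt T (A r / r) r := fun r hr =>
    intervalIntegral.integral_hasDerivAt_right
      (((hAdiv hD).mono fun t ht => lt_of_lt_of_le (lt_min one_pos hr) ht.1).intervalIntegrable)
      ((hAdiv hD).stronglyMeasurableAtFilter isOpen_Ioi r hr)
      ((hAdiv hD).continuousAt (Ioi_mem_nhds hr))
  have hTlog : ∀ r, 1 ≤ r → A 1 * log r ≤ T r := by
    intro r hr
    have h1 : ∫ t in (1 : ℝ)..r, A 1 * t⁻¹ = A 1 * log r := by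
      rw [intervalIntegral.integral_const_mul, integral_inv_of_pos one_pos (by linarith), div_one]
    rw [← h1]
    refine intervalIntegral.integral_mono_on hr (ContinuousOn.intervalIntegrable fun t ht => ?_)
      (hII hD r hr) fun t ht => ?_
    · rw [Set.uIcc_of_le hr] at ht
      have : t ≠ 0 := by linarith [ht.1]
      exact ContinuousAt.continuousWithinAt (by fun_prop (disch := assumption))
    · rw [← div_eq_mul_inv]
      exact div_le_div_of_nonneg_right (hAge t ht.1) (by linarith [ht.1])
  -- T grows at least like A(1) log r. Past r₀ the right-hand side absorbs constants, and [1, r₀]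
  -- joins the exceptional set.
  obtain ⟨r₀, hr₀, hr₀'⟩ : ∃ r₀ : ℝ, 1 ≤ r₀ ∧ ∀ r, r₀ ≤ r → 1 ≤ log r ∧ 1 ≤ T r := by
    refine ⟨exp (max 1 (1 / A 1)), one_le_exp (le_max_of_le_left zero_le_one), fun r hr => ?_⟩
    have h1 : max 1 (1 / A 1) ≤ log r := by
      rw [← log_exp (max 1 (1 / A 1))]
      exact log_le_log (exp_pos _) hr
    have h2 : 1 ≤ r := (one_le_exp (le_max_of_le_left zero_le_one)).trans hr
    refine ⟨(le_max_left _ _).trans h1, ?_⟩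
    have h3 := (div_le_iff₀' hA1).mp ((le_max_right 1 (1 / A 1)).trans h1)
    exact h3.trans (hTlog r h2)
  have hpos : ∀ r, r₀ ≤ r → 0 < r := fun r hr => by linarith
  -- Borel's lemma is applied to T, with T' = A/r, and then to A, with A' = 2πr times the circle
  -- average of D.
  have hS1 : volume {r | r₀ < r ∧ T r ^ 2 < A r / r} < ⊤ :=
    volume_sq_lt_deriv_lt_top (fun r hr => hT r (hpos r hr))
      ((hAdiv hD).mono fun r hr => hpos r hr)
      (fun r hr => div_nonneg (hA1.le.trans (hAge r (hr₀.trans hr))) (hpos r hr).le)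
      (fun r hr => by linarith [(hr₀' r hr).2])
  have hS2 : volume {r | r₀ < r ∧ A r ^ 2 < 2 * π * (r * circleAverage D 0 r)} < ⊤ :=
    volume_sq_lt_deriv_lt_top (fun r _ => hA hD r) (hP hD).continuousOn
      (fun r hr => mul_nonneg (by positivity) (mul_nonneg (hpos r hr).le
        (circleAverage_nonneg_of_nonneg fun z _ => hD0 z)))
      (fun r hr => hA1.trans_le (hAge r (hr₀.trans hr)))
  set K := |circleAverage (fun z => log (D z)) 0 1|
  refine ⟨π / 2 * (5 + K), by positivity, Set.Icc 1 r₀ ∪ ({r | r₀ < r ∧ T r ^ 2 < A r / r} ∪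
    {r | r₀ < r ∧ A r ^ 2 < 2 * π * (r * circleAverage D 0 r)}), ?_, fun r hr1 hrS => ?_⟩
  · exact (measure_union_le _ _).trans_lt (ENNReal.add_lt_top.mpr ⟨by simp,
      (measure_union_le _ _).trans_lt (ENNReal.add_lt_top.mpr ⟨hS1, hS2⟩)⟩)
  · simp only [Set.mem_union, Set.mem_Icc, Set.mem_ofPred_eq, not_or, not_and, not_lt, not_le] at hrS
    obtain ⟨hr0, hrT, hrA⟩ := hrS
    have hr := hr0 hr1
    have hrpos := hpos r hr.le
    obtain ⟨hlog, hT1⟩ := hr₀' r hr.le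
    have hAT : A r ≤ r * T r ^ 2 := by
      have := (div_le_iff₀ hrpos).mp (hrT hr)
      linarith
    have hA0 : 0 ≤ A r := hA1.le.trans (hAge r hr1)
    have hP0 : 0 ≤ circleAverage D 0 r := circleAverage_nonneg_of_nonneg fun z _ => hD0 z
    -- From A ≤ rT² and r·avg(D) ≤ A². The logarithm gives 1 + log r + 4 log T + K, which (5 +
    -- K)(log r + log T) dominates as log r ≥ 1.
    have hPT : circleAverage D 0 r ≤ r * T r ^ 4 := by
      have h1 : r * circleAverage D 0 r ≤ 2 * π * (r * circleAverage D 0 r) :=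
        le_mul_of_one_le_left (by positivity) (by linarith [pi_gt_three])
      have h2 : A r ^ 2 ≤ (r * T r ^ 2) ^ 2 := pow_le_pow_left₀ hA0 hAT 2
      have h3 : r * circleAverage D 0 r ≤ r * (r * T r ^ 4) := by
        calc _ ≤ _ := h1
          _ ≤ _ := hrA hr
          _ ≤ _ := h2
          _ = _ := by ring
      exact le_of_mul_le_mul_left h3 hrpos
    have hc : 1 ≤ r * T r ^ 4 := one_le_mul_of_one_le_of_one_le hr1 (one_le_pow₀ hT1)
    obtain ⟨hci, hle⟩ := h.charFun_le hr1
    have hav := circleAverage_log_le hD hD0 hci hc hPT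
    rw [log_mul hrpos.ne' (by positivity), log_pow] at hav
    push_cast at hav
    have hlogT : 0 ≤ log (T r) := log_nonneg hT1
    have hK' : -K ≤ circleAverage (fun z => log (D z)) 0 1 := neg_abs_le _
    have hK0 : 0 ≤ K := abs_nonneg _
    beta_reduce
    rw [one_mul, ← hadd r hr1, show charFun D r = T r from hchar hD r hr1]
    refine hle.trans ?_
    rw [mul_assoc]
    refine mul_le_mul_of_nonneg_left ?_ (by positivity)
    nlinarith

end Nevanlinna

end EntireCurve

end

/-! ### Assembly of (a) and (b). -/

theorem theorem6p15 (p : ℕ) (h : EntireCurve.Sesq p) (hh : EntireCurve.HasSignature h) :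
    (∀ (f g : ℂ → Projectivization ℂ (EntireCurve.V p)) (x y : ℂ),
      EntireCurve.PositiveGerm h f x → EntireCurve.PositiveGerm h g y →
      ∀ (i : Fin (p + 3)) (j : Fin (p + 2)),
        EntireCurve.Lift1InChart i j f x → EntireCurve.Lift1InChart i j g y →
        EntireCurve.lift2 i j f x = EntireCurve.lift2 i j g y →
        ∀ c : ℂ, EntireCurve.velocity1 i j f x = c • EntireCurve.velocity1 i j g y →
          EntireCurve.sigmaDensity h f x = ‖c‖ ^ 2 * EntireCurve.sigmaDensity h g y) ∧
    ∃ γ : ℝ, 0 < γ ∧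
      (∀ (i : Fin (p + 3)) (w u : EntireCurve.E p),
        0 < (h (EntireCurve.chartSection i w) (EntireCurve.chartSection i w)).re →
        0 < (EntireCurve.herm (EntireCurve.gram h i w) u u).re →
        EntireCurve.holSecCurv h i w u = -(γ : ℂ)) ∧
      ∀ f : ℂ → Projectivization ℂ (EntireCurve.V p),
        (∀ x, EntireCurve.HolomorphicNear f x) → (∀ x, f x ∈ EntireCurve.Omega h) →
        (¬ ∃ l, ∀ x, f x = l) → (∀ x, EntireCurve.PositiveAt h f x) →
        Continuous (EntireCurve.pullbackDensity h f) ∧ Continuous (EntireCurve.sigmaDensity h f) ∧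
        EntireCurve.LeExcO
          (fun r => γ * EntireCurve.charFun (EntireCurve.pullbackDensity h f) r +
            EntireCurve.charFun (EntireCurve.sigmaDensity h f) r)
          (fun r => Real.log r +
            Real.log (EntireCurve.charFun (EntireCurve.pullbackDensity h f) r)) := by
  refine ⟨fun f g x y hf hg i j hfij hgij hlift c hc => ?_, 1, one_pos,
    fun i w u hw hu => ?_, fun f hf hΩ _ hpos => ?_⟩
  · have h1 : EntireCurve.lift1 i j f x x = EntireCurve.lift1 i j g y y := congrArg Prod.fst hlift
    have h2 : (j.insertNth (α := fun _ => ℂ) 0 (c • (EntireCurve.velocity1 i j g y).2) :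
        EntireCurve.E p) = c • j.insertNth (α := fun _ => ℂ) 0 (EntireCurve.velocity1 i j g y).2 := by
      ext l
      refine Fin.succAboveCases j ?_ ?_ l <;> simp
    rw [hf.sigmaDensity_eq_lift1 hh hfij, hg.sigmaDensity_eq_lift1 hh hgij, h1, hc, Prod.smul_snd,
      h2, map_smul, EntireCurve.frameSigma_smul_right, Complex.star_def, Complex.mul_conj,
      Complex.normSq_eq_norm_sq, Complex.re_ofReal_mul]
  · rw [EntireCurve.holSecCurv_eq hh hw (EntireCurve.ne_zero_of_re_pos hu), Complex.ofReal_one]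
  · have hloc := EntireCurve.exists_local_potential hh hf hΩ hpos
    have hσ : Continuous (EntireCurve.sigmaDensity h f) :=
      continuous_iff_continuousAt.mpr fun x => (hloc x).1
    have hpot : EntireCurve.HasPotentials (EntireCurve.pullbackDensity h f)
        (fun z => EntireCurve.pullbackDensity h f z + EntireCurve.sigmaDensity h f z) :=
      fun x => (hloc x).2
    exact ⟨hpot.continuous, hσ, hpot.leExcO hσ⟩
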